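/- Let $\mathbb{K}$ be a skew field and let $R=\mathbb{K}[t_1^{\pm1},\dots,t_m^{\pm1}]$ be a multivariable skew Laurent polynomial ring of rank $m$ over $\mathbb{K}$: a ring $R$ containing $\mathbb{K}$ as a (not necessarily central) subring, together with a decomposition $R=\bigoplus_{\alpha\in\mathbb{Z}^m}V_\alpha$ such that each $V_\alpha$ is a one-dimensional left $\mathbb{K}$-vector space, $V_\alpha\cdot V_\beta=V_{\alpha+\beta}$ for all $\alpha,\beta$, and $V_0=\mathbb{K}$. The ring $R$ is an Ore domain; let $\mathbb{K}(t_1,\dots,t_m)$ be its skew quotient field, and write $\mathbb{K}(t_1,\dots,t_m)^\times_{ab}$ for the abelianization of its multiplicative group. For a skew field $\mathcal{K}$ let $\mathrm{GL}(\mathcal{K})=\varinjlim_n \mathrm{GL}(\mathcal{K},n)$ with respect to $A\mapsto \mathrm{diag}(A,1)$, let $K_1(\mathcal{K})=\mathrm{GL}(\mathcal{K})/[\mathrm{GL}(\mathcal{K}),\mathrm{GL}(\mathcal{K})]$, and let $\det(\tau)\in\mathcal{K}^\times_{ab}$ denote the Dieudonné determinant of $\tau\in K_1(\mathcal{K})$,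 i.e. the class of those $d\in\mathcal{K}^\times$ for which the $1\times1$ matrix $(d)$ represents $\tau$. For $f\in R$ with components $f_\alpha\in V_\alpha$ and $\phi\in\mathrm{Hom}(\mathbb{R}^m,\mathbb{R})$ put $\|\phi\|_f=\sup\{\phi(\alpha)-\phi(\beta)\mid f_\alpha\neq0,\ f_\beta\neq0\}$ if $f\ne 0$, and $\|\phi\|_0=0$. Theorem. Let $\tau\in K_1(\mathbb{K}(t_1,\dots,t_m))$ be represented by a square matrix with entries in $R$ (invertible over $\mathbb{K}(t_1,\dots,t_m)$). Then there are nonzero $f_n,f_d\in R$ with $\det(\tau)=f_nf_d^{-1}$ in $\mathbb{K}(t_1,\dots,t_m)^\times_{ab}$, the function $$\|\phi\|_\tau=\max\{0,\ \|\phi\|_{f_n}-\|\phi\|_{f_d}\}$$ does not depend on the choice of such $f_n,f_d$, and $\|\cdot\|_\tau$ is a seminorm on the real vector space $\mathrm{Hom}(\mathbb{R}^m,\mathbb{R})$. -/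

import Mathlib

namespace SkewLaurent

open scoped nonZeroDivisors Pointwise

/-- `R` together with the decomposition `R = ⨁ V α`, `α ∈ ℤ^m`, is a multivariable skew Laurent
polynomial ring of rank `m` over the skew field `K`. The ring `R` contains `K` through `k ↦ k • 1`
(`Module K R` and `IsScalarTower K R R` say exactly that `k ↦ k • 1` is a ring homomorphism and
that `k • x` is the product `(k • 1) * x`; `K` need not be central in `R`). The product of two
additive subgroups is the additive subgroup generated by the products of their elements. -/
class IsSkewLaurentGrading {K R : Type*} [DivisionRing K] [Ring R] [Module K R]
    [IsScalarTower K R R] {m : ℕ} (V : (Fin m → ℤ) → Submodule K R) : Prop where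
  isInternal : DirectSum.IsInternal V
  finrank_eq_one : ∀ α, Module.finrank K (V α) = 1
  mul_eq : ∀ α β,
    (V α).toAddSubgroup * (V β).toAddSubgroup = (V (α + β)).toAddSubgroup
  zero_eq : V 0 = Submodule.span K {1}

section
variable {K R : Type*} [DivisionRing K] [Ring R] [Module K R] [IsScalarTower K R R] {m : ℕ}
  (V : (Fin m → ℤ) → Submodule K R) [hV : IsSkewLaurentGrading V]

/-- The component in `V α` of an element `f`: the term `a_α t^α` in `f = ∑ a_α t^α`. -/
noncomputable def component (f : R) (α : Fin m → ℤ) : R :=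
  ((Equiv.ofBijective _ hV.isInternal).symm f) α

/-- The set of all `α` with `a_α ≠ 0`, where `f = ∑ a_α t^α`; the choice of the nonzero elements
`t^α ∈ V α` does not matter. -/
def support (f : R) : Set (Fin m → ℤ) := {α | component V f α ≠ 0}

theorem gradedMonoid : SetLike.GradedMonoid V where
  one_mem := by
    rw [hV.zero_eq]
    exact Submodule.mem_span_singleton_self 1
  mul_mem := by
    intro α β x y hx hy
    have h : x * y ∈ (V α).toAddSubgroup * (V β).toAddSubgroup := AddSubmonoid.mul_mem_mul hx hy
    rw [hV.mul_eq] at h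
    exact h

theorem eq_smul {α : Fin m → ℤ} {x y : R} (hx : x ∈ V α) (hx0 : x ≠ 0) (hy : y ∈ V α) :
    ∃ k : K, k • x = y := by
  obtain ⟨k, hk⟩ := (finrank_eq_one_iff_of_nonzero' (⟨x, hx⟩ : V α)
    (fun h => hx0 (congrArg Subtype.val h))).1 (hV.finrank_eq_one α) ⟨y, hy⟩
  exact ⟨k, congrArg Subtype.val hk⟩

theorem exists_left_inv {α : Fin m → ℤ} {x : R} (hx : x ∈ V α) (hx0 : x ≠ 0) :
    ∃ y, y * x = 1 := by
  have h1 : (1 : R) ∈ (V (-α)).toAddSubgroup * (V α).toAddSubgroup := by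
    rw [hV.mul_eq, neg_add_cancel]
    exact (gradedMonoid V).one_mem
  have key : ∀ z ∈ (V (-α)).toAddSubgroup * (V α).toAddSubgroup, ∃ y, y * x = z := by
    intro z hz
    refine AddSubmonoid.mul_induction_on hz ?_ ?_
    · intro a ha b hb
      obtain ⟨k, rfl⟩ := eq_smul V hx hx0 hb
      exact ⟨a * (k • 1), by rw [mul_assoc, smul_mul_assoc, one_mul]⟩
    · rintro a b ⟨y, rfl⟩ ⟨z, rfl⟩
      exact ⟨y + z, add_mul _ _ _⟩
  exact key 1 h1

theorem nontrivial {K R : Type*} [DivisionRing K] [Ring R] [Module K R]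
    [IsScalarTower K R R] {m : ℕ} (V : (Fin m → ℤ) → Submodule K R)
    [hV : IsSkewLaurentGrading V] : Nontrivial R := by
  by_contra h
  rw [not_nontrivial_iff_subsingleton] at h
  have := hV.finrank_eq_one 0
  rw [Module.finrank_zero_of_subsingleton] at this
  exact zero_ne_one this

theorem exists_basis {K R : Type*} [DivisionRing K] [Ring R] [Module K R]
    [IsScalarTower K R R] {m : ℕ} (V : (Fin m → ℤ) → Submodule K R)
    [hV : IsSkewLaurentGrading V] : ∃ b : Module.Basis (Fin m → ℤ) K R, ∀ α, V α = Submodule.span K {b α} := by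
  have ht : ∀ α, ∃ t ∈ V α, t ≠ 0 := by
    intro α
    have : Nontrivial (V α) := Module.nontrivial_of_finrank_eq_succ (hV.finrank_eq_one α)
    obtain ⟨t, ht⟩ := exists_ne (0 : V α)
    exact ⟨t, t.2, fun h => ht (Subtype.ext h)⟩
  choose t ht ht0 using ht
  have hspan : ∀ α, V α = Submodule.span K {t α} := by
    intro α
    refine le_antisymm ?_ ((Submodule.span_singleton_le_iff_mem _ _).2 (ht α))
    intro y hy
    exact Submodule.mem_span_singleton.2 (eq_smul V (ht α) (ht0 α) hy)
  have hli : LinearIndependent K t :=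
    hV.isInternal.submodule_iSupIndep.linearIndependent V ht ht0
  have htop : ⊤ ≤ Submodule.span K (Set.range t) := by
    rw [← hV.isInternal.submodule_iSup_eq_top]
    refine iSup_le fun α => ?_
    rw [hspan]
    exact Submodule.span_mono (by rintro _ rfl; exact ⟨α, rfl⟩)
  exact ⟨Module.Basis.mk hli htop, by simpa using hspan⟩

theorem noZeroDivisors {K R : Type*} [DivisionRing K] [Ring R] [Module K R]
    [IsScalarTower K R R] {m : ℕ} (V : (Fin m → ℤ) → Submodule K R)
    [hV : IsSkewLaurentGrading V] : NoZeroDivisors R where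
  eq_zero_or_eq_zero_of_mul_eq_zero := by
    classical
    intro f g hfg
    obtain ⟨b, hb⟩ := exists_basis V
    by_contra! hne
    have hmem : ∀ (k : K) α, k • b α ∈ V α := fun k α => by
      rw [hb]; exact Submodule.smul_mem _ _ (Submodule.mem_span_singleton_self _)
    have hzero : ∀ γ δ x, x ∈ V γ → γ ≠ δ → b.repr x δ = 0 := by
      intro γ δ x hx hγ
      rw [hb, Submodule.mem_span_singleton] at hx
      obtain ⟨k, rfl⟩ := hx
      simp [hγ]
    have hsum : ∀ x : R, x = ∑ α ∈ (b.repr x).support, b.repr x α • b α := fun x =>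
      (b.linearCombination_repr x).symm.trans (Finsupp.linearCombination_apply K _)
    have hne' : ∀ x : R, x ≠ 0 → (b.repr x).support.Nonempty := by
      intro x hx
      rw [Finset.nonempty_iff_ne_empty, Ne, Finsupp.support_eq_empty]
      simpa using hx
    have hunit : ∀ x : R, ∀ α ∈ (b.repr x).support, b.repr x α • b α ≠ 0 := by
      intro x α hα
      exact smul_ne_zero (Finsupp.mem_support_iff.1 hα)
        (have := nontrivial V; b.ne_zero α)
    obtain ⟨α, hα, β, hβ, hu⟩ := UniqueSums.uniqueAdd_of_nonempty (hne' f hne.1) (hne' g hne.2)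
    set x := b.repr f α • b α with hx
    set y := b.repr g β • b β with hy
    have hxy : x * y ∈ V (α + β) := (gradedMonoid V).mul_mem (hmem _ _) (hmem _ _)
    have h : b.repr (f * g) (α + β) = b.repr (x * y) (α + β) := by
      rw [hsum f, hsum g, Finset.sum_mul_sum, ← Finset.sum_product', map_sum,
        Finsupp.finsetSum_apply]
      apply Finset.sum_eq_single (α, β)
      · rintro ⟨i, j⟩ hij hn
        rw [Finset.mem_product] at hij
        refine hzero (i + j) _ _ ((gradedMonoid V).mul_mem (hmem _ _) (hmem _ _)) fun he => hn ?_
        obtain ⟨rfl, rfl⟩ := hu hij.1 hij.2 he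
        rfl
      · intro hn
        exact absurd (Finset.mem_product.2 ⟨hα, hβ⟩) hn
    rw [hfg, map_zero, Finsupp.zero_apply] at h
    have hxy0 : x * y = 0 := by
      apply b.repr.injective
      rw [map_zero]
      ext δ
      by_cases hδ : α + β = δ
      · rw [← hδ, ← h, Finsupp.zero_apply]
      · exact hzero _ _ _ hxy hδ
    obtain ⟨z, hz⟩ := exists_left_inv V (hmem _ _) (hunit f α hα)
    apply hunit g β hβ
    calc y = z * x * y := by rw [hz, one_mul]
      _ = 0 := by rw [mul_assoc, hxy0, mul_zero]

theorem mem_span_image {b : Module.Basis (Fin m → ℤ) K R} (hb : ∀ α, V α = Submodule.span K {b α})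
    (r : R) {S T : Finset (Fin m → ℤ)} (hST : ∀ α ∈ S, ∀ β ∈ (b.repr r).support, α + β ∈ T)
    {α : Fin m → ℤ} (hα : α ∈ S) : b α * r ∈ Submodule.span K (b '' (T : Set (Fin m → ℤ))) := by
  have hmem : ∀ α, b α ∈ V α := fun α => by rw [hb]; exact Submodule.mem_span_singleton_self _
  suffices h : b α * Finsupp.linearCombination K b (b.repr r) ∈
      Submodule.span K (b '' (T : Set (Fin m → ℤ))) by rwa [b.linearCombination_repr] at h
  rw [Finsupp.linearCombination_apply, Finsupp.sum, Finset.mul_sum]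
  refine Submodule.sum_mem _ fun β hβ => ?_
  have h := (gradedMonoid V).mul_mem (hmem α) (Submodule.smul_mem _ (b.repr r β) (hmem β))
  rw [hb] at h
  refine Submodule.span_mono ?_ h
  rintro _ rfl
  exact ⟨α + β, hST α hα β hβ, rfl⟩

theorem card_lt (m c : ℕ) : (2 * (2 * c * m + c) + 1) ^ m < 2 * (2 * (2 * c * m) + 1) ^ m := by
  have hD : (0 : ℝ) < 2 * (2 * c * m + c) + 1 := by positivity
  have hx : (-2 : ℝ) ≤ -(2 * c / (2 * (2 * c * m + c) + 1)) := by
    rw [neg_le_neg_iff, div_le_iff₀ hD]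
    have : (0 : ℝ) ≤ c * m := by positivity
    have : (0 : ℝ) ≤ c := by positivity
    nlinarith
  have h := one_add_mul_le_pow hx m
  have e : 1 + -(2 * (c : ℝ) / (2 * (2 * c * m + c) + 1)) =
      (2 * (2 * c * m) + 1) / (2 * (2 * c * m + c) + 1) := by
    field_simp
    ring
  rw [e, div_pow] at h
  have h2 : (1 : ℝ) / 2 < 1 + m * -(2 * c / (2 * (2 * c * m + c) + 1)) := by
    have : (m : ℝ) * (2 * c / (2 * (2 * c * m + c) + 1)) < 1 / 2 := by
      rw [← mul_div_assoc, div_lt_iff₀ hD]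
      have : (0 : ℝ) ≤ c := by positivity
      nlinarith
    linarith
  have h3 := h2.trans_le h
  rw [lt_div_iff₀ (by positivity)] at h3
  have h4 : (2 * (2 * c * m + c) + 1 : ℝ) ^ m < 2 * (2 * (2 * c * m) + 1) ^ m := by linarith
  exact_mod_cast h4

theorem ore_condition {K R : Type*} [DivisionRing K] [Ring R] [Module K R]
    [IsScalarTower K R R] {m : ℕ} (V : (Fin m → ℤ) → Submodule K R)
    [hV : IsSkewLaurentGrading V] (r : R) (s : R⁰) : ∃ (r' : R) (s' : R⁰), s' * r = r' * s := by
  classical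
  have := nontrivial V
  have := noZeroDivisors V
  by_cases hr : r = 0
  · exact ⟨0, 1, by simp [hr]⟩
  obtain ⟨b, hb⟩ := exists_basis V
  let A := (b.repr r).support ∪ (b.repr (s : R)).support
  obtain ⟨c, hc⟩ : ∃ c : ℕ, ∀ β ∈ A, ∀ i, |β i| ≤ c := by
    refine ⟨∑ β ∈ A, ∑ i, (β i).natAbs, fun β hβ i => ?_⟩
    rw [Int.abs_eq_natAbs]
    have h1 : (β i).natAbs ≤ ∑ i, (β i).natAbs :=
      Finset.single_le_sum (f := fun i => (β i).natAbs) (fun _ _ => Nat.zero_le _)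
        (Finset.mem_univ i)
    have h2 : ∑ i, (β i).natAbs ≤ ∑ β ∈ A, ∑ i, (β i).natAbs :=
      Finset.single_le_sum (f := fun β : Fin m → ℤ => ∑ i, (β i).natAbs)
        (fun _ _ => Nat.zero_le _) hβ
    exact_mod_cast h1.trans h2
  let box : ℕ → Finset (Fin m → ℤ) := fun N => Finset.Icc (fun _ => -(N : ℤ)) (fun _ => (N : ℤ))
  have hbox : ∀ N, (box N).card = (2 * N + 1) ^ m := by
    intro N
    simp only [box, Pi.card_Icc, Int.card_Icc, Finset.prod_const, Finset.card_univ,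
      Fintype.card_fin]
    congr 1
    omega
  have hmem : ∀ N α, α ∈ box N ↔ ∀ i, |α i| ≤ N := by
    intro N α
    simp only [box, Finset.mem_Icc, Pi.le_def, abs_le, ← forall_and]
  let N := 2 * c * m
  have hST : ∀ α ∈ box N, ∀ β ∈ A, α + β ∈ box (N + c) := by
    intro α hα β hβ
    rw [hmem] at hα ⊢
    intro i
    push_cast
    exact (abs_add_le _ _).trans (add_le_add (hα i) (hc β hβ i))
  let P : (box N → K) →ₗ[K] R := Fintype.linearCombination K (fun α : box N => b α)
  have hPinj : ∀ x, P x = 0 → x = 0 := by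
    intro x hx
    have hli : LinearIndependent K (fun α : box N => b α) :=
      b.linearIndependent.comp _ Subtype.val_injective
    rw [Fintype.linearIndependent_iff] at hli
    funext i
    exact hli x (by simpa [P, Fintype.linearCombination_apply] using hx) i
  let mulR : R → R →ₗ[K] R := fun r => 
    { toFun := fun x => x * r
      map_add' := fun x y => add_mul x y r
      map_smul' := fun k x => smul_mul_assoc k x r }
  have hP : ∀ q : R, (∀ α ∈ (b.repr q).support, α ∈ A) → ∀ x,
      P x * q ∈ Submodule.span K (b '' (box (N + c) : Set (Fin m → ℤ))) := by
    intro q hq x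
    simp only [P, Fintype.linearCombination_apply, Finset.sum_mul, smul_mul_assoc]
    refine Submodule.sum_mem _ fun α _ => Submodule.smul_mem _ _ ?_
    exact mem_span_image V hb q (fun α hα β hβ => hST α hα β (hq β hβ)) α.2
  let Φ : ((box N → K) × (box N → K)) →ₗ[K] R :=
    (mulR r ∘ₗ P) ∘ₗ LinearMap.fst K _ _ - (mulR s ∘ₗ P) ∘ₗ LinearMap.snd K _ _
  have hΦ : ∀ x, Φ x = P x.1 * r - P x.2 * s := fun x => rfl
  let Ψ := (LinearMap.funLeft K K (Subtype.val : box (N + c) → (Fin m → ℤ))) ∘ₗ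
    Finsupp.lcoeFun ∘ₗ (b.repr : R →ₗ[K] _) ∘ₗ Φ
  have hker : LinearMap.ker Ψ ≠ ⊥ := by
    apply LinearMap.ker_ne_bot_of_finrank_lt
    rw [Module.finrank_prod, Module.finrank_fintype_fun_eq_card,
      Module.finrank_fintype_fun_eq_card, Fintype.card_coe, Fintype.card_coe, hbox, hbox, ← two_mul]
    exact card_lt m c
  obtain ⟨x, hx, hx0⟩ := Submodule.exists_mem_ne_zero_of_ne_bot hker
  have hz : Φ x = 0 := by
    have h1 : Φ x ∈ Submodule.span K (b '' (box (N + c) : Set (Fin m → ℤ))) := by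
      rw [hΦ]
      exact Submodule.sub_mem _ (hP r (fun α h => Finset.mem_union_left _ h) _)
        (hP s (fun α h => Finset.mem_union_right _ h) _)
    rw [b.mem_span_image] at h1
    apply b.repr.injective
    rw [map_zero]
    ext α
    by_contra hα
    have h2 : α ∈ box (N + c) := h1 (Finsupp.mem_support_iff.2 hα)
    exact hα (congrFun (LinearMap.mem_ker.1 hx) ⟨α, h2⟩)
  rw [hΦ, sub_eq_zero] at hz
  have hu : P x.1 ≠ 0 := by
    intro h0
    rw [h0, zero_mul, eq_comm, mul_eq_zero, or_iff_left (nonZeroDivisors.coe_ne_zero s)] at hz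
    exact hx0 (Prod.ext (hPinj _ h0) (hPinj _ hz))
  exact ⟨P x.2, ⟨P x.1, mem_nonZeroDivisors_of_ne_zero hu⟩, hz⟩

/-- The skew Laurent polynomial ring is a left Ore domain. -/
@[reducible] noncomputable def oreSet : OreLocalization.OreSet R⁰ :=
  have := noZeroDivisors V
  Classical.choice (OreLocalization.nonempty_oreSet_iff_of_noZeroDivisors.2 (ore_condition V))

/-- The skew quotient field of the skew Laurent polynomial ring: the Ore localization at all nonzero
elements. -/
def QuotientField : Type _ :=
  letI := oreSet V
  OreLocalization R⁰ R

noncomputable instance : DivisionRing (QuotientField V) :=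
  letI := oreSet V
  have := nontrivial V
  have := noZeroDivisors V
  inferInstanceAs (DivisionRing (OreLocalization R⁰ R))

/-- The canonical embedding of the skew Laurent polynomial ring into its quotient field. -/
noncomputable def toQuotientField : R →+* QuotientField V :=
  letI := oreSet V
  (OreLocalization.numeratorRingHom : R →+* OreLocalization R⁰ R)

theorem toQuotientField_injective : Function.Injective (toQuotientField V) :=
  letI := oreSet V
  OreLocalization.numeratorHom_inj inf_le_left

theorem toQuotientField_ne_zero {f : R} (hf : f ≠ 0) : toQuotientField V f ≠ 0 :=
  (map_ne_zero_iff _ (toQuotientField_injective V)).2 hf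

/-- The fraction `f_n f_d⁻¹` of nonzero `f_n`, `f_d`, as a unit of the quotient field. -/
noncomputable def fraction (fn fd : R) (hn : fn ≠ 0) (hd : fd ≠ 0) : (QuotientField V)ˣ :=
  Units.mk0 (toQuotientField V fn) (toQuotientField_ne_zero V hn) *
    (Units.mk0 (toQuotientField V fd) (toQuotientField_ne_zero V hd))⁻¹

end

section KTheory

/-- The block matrix `diag(A, 1)` of size `k`, for `A` of size `n ≤ k`. -/
def extendMatrix {D : Type*} [Ring D] {n k : ℕ} (A : Matrix (Fin n) (Fin n) D) :
    Matrix (Fin k) (Fin k) D := fun r s =>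
  if h : r.1 < n ∧ s.1 < n then A ⟨r, h.1⟩ ⟨s, h.2⟩ else if r = s then 1 else 0

theorem extendMatrix_one {D : Type*} [Ring D] {n k : ℕ} :
    extendMatrix (1 : Matrix (Fin n) (Fin n) D) = (1 : Matrix (Fin k) (Fin k) D) := by
  ext r s
  by_cases h : r.1 < n ∧ s.1 < n
  · simp [extendMatrix, h, Matrix.one_apply, Fin.ext_iff]
  · simp [extendMatrix, h, Matrix.one_apply]

theorem extendMatrix_mul {D : Type*} [Ring D] {n k : ℕ} (hnk : n ≤ k)
    (A B : Matrix (Fin n) (Fin n) D) :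
    (extendMatrix (A * B) : Matrix (Fin k) (Fin k) D) = extendMatrix A * extendMatrix B := by
  ext r s
  rw [Matrix.mul_apply]
  by_cases hr : r.1 < n
  · by_cases hs : s.1 < n
    · rw [← Fintype.sum_of_injective (Fin.castLE hnk) (Fin.castLE_injective hnk)
        (fun t => A ⟨r, hr⟩ t * B t ⟨s, hs⟩)]
      · simp [extendMatrix, hr, hs, Matrix.mul_apply]
      · intro t ht
        have h : ¬ t.1 < n := fun h => ht ⟨⟨t, h⟩, rfl⟩
        have h' : r ≠ t := fun e => h (e ▸ hr)
        simp [extendMatrix, h, h']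
      · intro t
        simp [extendMatrix, hr, hs]
    · have hrs : r ≠ s := fun e => hs (e ▸ hr)
      symm
      rw [show extendMatrix (A * B) r s = 0 by simp [extendMatrix, hs, hrs]]
      refine Finset.sum_eq_zero fun t _ => ?_
      by_cases ht : t = s
      · subst ht; simp [extendMatrix, hs, hrs]
      · simp [extendMatrix, hs, ht]
  · rw [Finset.sum_eq_single r]
    · simp [extendMatrix, hr]
    · intro t _ ht
      simp [extendMatrix, hr, Ne.symm ht]
    · simp

/-- The transition map `GL(D, n) → GL(D, k)`, `A ↦ diag(A, 1)`, for `n ≤ k`. -/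
def stabilize (D : Type*) [Ring D] (n k : ℕ) (hnk : n ≤ k) :
    (Matrix (Fin n) (Fin n) D)ˣ →* (Matrix (Fin k) (Fin k) D)ˣ :=
  Units.map
    { toFun := extendMatrix
      map_one' := extendMatrix_one
      map_mul' := extendMatrix_mul hnk }

instance (D : Type*) [Ring D] :
    DirectedSystem (fun n : ℕ => (Matrix (Fin n) (Fin n) D)ˣ) (stabilize D · · ·) where
  map_self i A := by
    ext r s
    simp [stabilize, extendMatrix]
  map_map k j i hij hjk A := by
    ext r s
    simp only [stabilize, Units.coe_map, MonoidHom.coe_mk, OneHom.coe_mk, extendMatrix, Fin.ext_iff]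
    split_ifs <;> first | rfl | omega

/-- The stable general linear group `GL(D)`, the direct limit of the groups `GL(D, n)`. -/
abbrev StableGL (D : Type*) [Ring D] : Type _ :=
  DirectLimit (fun n : ℕ => (Matrix (Fin n) (Fin n) D)ˣ) (stabilize D)

/-- `K₁(D) = GL(D) / [GL(D), GL(D)]`. -/
abbrev K₁ (D : Type*) [Ring D] : Type _ := Abelianization (StableGL D)

/-- The canonical homomorphism `GL(D, n) → K₁(D)`. -/
noncomputable def K₁.ofGL (D : Type*) [Ring D] (n : ℕ) : (Matrix (Fin n) (Fin n) D)ˣ →* K₁ D :=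
  Abelianization.of.comp
    { toFun := fun A => ⟦⟨n, A⟩⟧
      map_one' := (DirectLimit.one_def n).symm
      map_mul' := fun A B => (DirectLimit.mul_def (f := stabilize D) n A B).symm }

/-- The homomorphism from the abelianized multiplicative group of `D` to `K₁(D)`
which sends the class of `d` to the class of the `1 × 1` matrix `(d)`. -/
noncomputable def K₁.ofUnits (D : Type*) [Ring D] : Abelianization Dˣ →* K₁ D :=
  Abelianization.lift ((K₁.ofGL D 1).comp (Units.map (Matrix.scalar (Fin 1) : D →+* _)))

/-- `d` is the Dieudonné determinant of `τ`, i.e. `τ` is represented in `K₁(D)` by the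
`1 × 1` matrix `(d)`. -/
def IsDieudonneDet {D : Type*} [DivisionRing D] (τ : K₁ D) (d : Abelianization Dˣ) : Prop :=
  K₁.ofUnits D d = τ

end KTheory

section
variable {K R : Type*} [DivisionRing K] [Ring R] [Module K R] [IsScalarTower K R R] {m : ℕ}
  (V : (Fin m → ℤ) → Submodule K R) [hV : IsSkewLaurentGrading V]

/-- `τ` is represented by a square matrix with entries in the skew Laurent polynomial ring
(which is invertible over the quotient field). -/
def IsRepresentedOverRing (τ : K₁ (QuotientField V)) : Prop :=
  ∃ (n : ℕ) (B : Matrix (Fin n) (Fin n) R) (A : (Matrix (Fin n) (Fin n) (QuotientField V))ˣ),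
    (A : Matrix (Fin n) (Fin n) (QuotientField V)) = B.map (toQuotientField V) ∧
      K₁.ofGL (QuotientField V) n A = τ

/-- The width `‖φ‖_f = sup {φ(α) - φ(β) | a_α ≠ 0, a_β ≠ 0}` of the support of `f = ∑ a_α t^α` in
direction `φ`. The supremum is over a finite set, and `sSup ∅ = 0` gives `‖φ‖_0 = 0`. -/
noncomputable def width (f : R) (φ : Module.Dual ℝ (Fin m → ℝ)) : ℝ :=
  sSup {x : ℝ | ∃ α ∈ support V f, ∃ β ∈ support V f,
    x = φ (fun i => (α i : ℝ)) - φ (fun i => (β i : ℝ))}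

/-- `det(τ) = f_n f_d⁻¹` in the abelianized multiplicative group of the quotient field. -/
def IsDetFraction (τ : K₁ (QuotientField V)) (fn fd : R) : Prop :=
  ∃ (hn : fn ≠ 0) (hd : fd ≠ 0), IsDieudonneDet τ (Abelianization.of (fraction V fn fd hn hd))

end
end SkewLaurent

/-! For nonzero `f` in `R` let h_f(φ) be the maximum of φ over the support of `f`. Leading parts
multiply without cancellation because `R` is a domain, so h_{fg} = h_f + h_g. Hence h extends to a
homomorphism from the unit group of the quotient field to the abelian group of real functions on the
dual space (`fieldValue`). Composed with the Dieudonné determinant it becomes a homomorphism on K₁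
(`K₁.det`), so h_τ = h_{f_n} - h_{f_d} is the same for every choice of fraction. Since the width of
`f` at φ is h_f(φ) + h_f(-φ), the difference of widths is independent of the choice as well.

The substance is that h_τ is subadditive, although a difference of convex functions need not be. Fix
a homomorphism deg from ℤ^m to ℤ. Once nonzero elements supported in ker deg are allowed as
denominators, `R` behaves like a Laurent polynomial ring in one variable over a skew field, with
division with remainder measured by degree width. Euclidean elimination on a matrix over `R`
therefore costs only factors supported in ker deg, and h_τ = h_r - h_u with `u` supported in ker deg
(`isDegZeroFraction_rowDet`).

For rational φ and ψ choose deg proportional to φ - ψ. Then φ and ψ agree on ker deg, so h_u(φ + ψ)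
= h_u(φ) + h_u(ψ), while h_r is subadditive; thus h_τ(φ + ψ) ≤ h_τ(φ) + h_τ(ψ). Continuity extends
this to all pairs. Consequently h_τ(φ) + h_τ(-φ) is subadditive and absolutely homogeneous, hence a
seminorm; being nonnegative, it equals its maximum with 0. -/

namespace SkewLaurent

/-! ### Determinants by Gaussian elimination with values in an abelian group with zero -/

section RowDet
variable {D G : Type*} [DivisionRing D] [CommGroupWithZero G]

/-- The rows of `A` without their last entry, after the last column has been cleared by the
row `i`. -/
def pivotReduce {ι : Type} {n : ℕ} (A : ι → Fin (n + 1) → D) (i : ι) : ι → Fin n → D :=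
  fun j k => A j k.castSucc - A j (Fin.last n) * (A i (Fin.last n))⁻¹ * A i k.castSucc

open Classical in
/-- The value under `χ` of the Dieudonné determinant of the rows `A i`, `i ∈ s`, computed by
Gaussian elimination from the last column on; it is `0` if the rows are linearly dependent. Since
signs are ignored, this is only meaningful if `χ (-1) = 1`. -/
noncomputable def rowDet (χ : D →*₀ G) :
    (n : ℕ) → {ι : Type} → [DecidableEq ι] → Finset ι → (ι → Fin n → D) → G
  | 0, _, _, _, _ => 1
  | n + 1, _, _, s, A =>
    if h : ∃ i ∈ s, A i (Fin.last n) ≠ 0 then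
      χ (A h.choose (Fin.last n)) * rowDet χ n (s.erase h.choose) (pivotReduce A h.choose)
    else 0

variable (χ : D →*₀ G)

theorem rowDet_succ_of_forall_eq_zero {n : ℕ} {ι : Type} [DecidableEq ι] {s : Finset ι}
    {A : ι → Fin (n + 1) → D} (h : ∀ i ∈ s, A i (Fin.last n) = 0) : rowDet χ (n + 1) s A = 0 := by
  rw [rowDet, dif_neg]
  push Not
  exact h

/-- The three invariance properties of `rowDet` which are proved simultaneously. -/
structure RowDetInvariance (n : ℕ) : Prop where
  add : ∀ {ι : Type} [DecidableEq ι] (s : Finset ι) (A : ι → Fin n → D) (c : ι → D) (j : ι),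
    s.card = n → j ∈ s → c j = 0 → rowDet χ n s (fun i k => A i k + c i * A j k) = rowDet χ n s A
  scale : ∀ {ι : Type} [DecidableEq ι] (s : Finset ι) (A : ι → Fin n → D) (x : ι → D),
    s.card = n → (∀ i ∈ s, x i ≠ 0) →
      rowDet χ n s (fun i k => x i * A i k) = (∏ i ∈ s, χ (x i)) * rowDet χ n s A
  map : ∀ {ι κ : Type} [DecidableEq ι] [DecidableEq κ] (s : Finset ι) (e : ι ↪ κ)
    (A : ι → Fin n → D) (B : κ → Fin n → D), s.card = n → (∀ i ∈ s, B (e i) = A i) →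
      rowDet χ n (s.map e) B = rowDet χ n s A

/-- Independence of the chosen pivot. The reductions by row `i` and by row `k` differ by row
additions, one row scaling and the relabelling that swaps `i` and `k`, all of which are controlled
in size `n`. The sign of the scaling disappears because χ(-1) = 1. -/
theorem RowDetInvariance.pivot_eq (hχ : χ (-1) = 1) {n : ℕ} (H : RowDetInvariance χ n) {ι : Type}
    [DecidableEq ι] (s : Finset ι) (A : ι → Fin (n + 1) → D) (hs : s.card = n + 1) {i k : ι}
    (hi : i ∈ s) (hk : k ∈ s) (hik : i ≠ k) (hAi : A i (Fin.last n) ≠ 0)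
    (hAk : A k (Fin.last n) ≠ 0) :
    χ (A k (Fin.last n)) * rowDet χ n (s.erase k) (pivotReduce A k) =
      χ (A i (Fin.last n)) * rowDet χ n (s.erase i) (pivotReduce A i) := by
  set a := fun j => A j (Fin.last n) with ha
  have hcard : (s.erase i).card = n := by rw [Finset.card_erase_of_mem hi, hs]; rfl
  have hk' : k ∈ s.erase i := Finset.mem_erase.2 ⟨hik.symm, hk⟩
  have hmap : (s.erase i).map (Equiv.swap i k).toEmbedding = s.erase k := by
    ext j
    simp only [Finset.mem_map_equiv, Equiv.symm_swap, Finset.mem_erase]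
    rcases eq_or_ne j i with rfl | hji
    · simp [hi, hk, hik, hik.symm]
    rcases eq_or_ne j k with rfl | hjk
    · simp
    · simp [Equiv.swap_apply_of_ne_of_ne hji hjk, hji, hjk]
  -- With a_j the last entry of row j: for j ≠ i, k, row j reduced by k is row j reduced by i minus
  -- a_j a_k⁻¹ times row k reduced by i. Row i reduced by k is -a_i a_k⁻¹ times row k reduced by i.
  let x : ι → D := fun j => if j = k then -(a i * (a k)⁻¹) else 1
  let c : ι → D := fun j => if j = k then 0 else -(a j * (a k)⁻¹)
  have hx : ∀ j ∈ s.erase i, x j ≠ 0 := by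
    intro j _
    simp only [x]
    split_ifs
    · exact neg_ne_zero.2 (mul_ne_zero hAi (inv_ne_zero hAk))
    · exact one_ne_zero
  have h1 := H.add (s.erase i) (pivotReduce A i) c k hcard hk' (if_pos rfl)
  have h2 := H.scale (s.erase i) (fun j l => pivotReduce A i j l + c j * pivotReduce A i k l) x
    hcard hx
  have h3 := H.map (s.erase i) (Equiv.swap i k).toEmbedding
    (fun j l => x j * (pivotReduce A i j l + c j * pivotReduce A i k l)) (pivotReduce A k) hcard (by
      intro j hj
      have hji := (Finset.mem_erase.1 hj).1
      funext l
      rcases eq_or_ne j k with rfl | hjk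
      · have h : A i (Fin.last n) * ((A j (Fin.last n))⁻¹ *
            (A j (Fin.last n) * ((A i (Fin.last n))⁻¹ * A i l.castSucc))) = A i l.castSucc := by
          rw [inv_mul_cancel_left₀ hAk, mul_inv_cancel_left₀ hAi]
        have hc : c j = 0 := if_pos rfl
        have hxj : x j = -(A i (Fin.last n) * (A j (Fin.last n))⁻¹) := if_pos rfl
        simp only [Equiv.coe_toEmbedding, Equiv.swap_apply_right, pivotReduce]
        rw [hxj, hc, zero_mul, add_zero]
        simp only [neg_mul, mul_sub, mul_assoc, h]
        abel
      · simp only [Equiv.coe_toEmbedding, Equiv.swap_apply_of_ne_of_ne hji hjk, pivotReduce, x, c,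
          if_neg hjk, one_mul]
        have : (a k)⁻¹ * (a k * ((a i)⁻¹ * A i l.castSucc)) = (a i)⁻¹ * A i l.castSucc := by
          rw [inv_mul_cancel_left₀ hAk]
        simp only [ha] at this ⊢
        simp only [neg_mul, mul_sub, mul_assoc, this]
        abel)
  have hprod : ∏ j ∈ s.erase i, χ (x j) = χ (a i) * (χ (a k))⁻¹ := by
    rw [Finset.prod_eq_single_of_mem k hk' (fun j _ hjk => by simp [x, hjk])]
    have : x k = -1 * (a i * (a k)⁻¹) := by simp [x]
    rw [this, map_mul, hχ, one_mul, map_mul, map_inv₀]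
  rw [hmap, h2, h1, hprod] at h3
  have hne : χ (a k) ≠ 0 := (map_ne_zero χ).2 hAk
  rw [h3]
  change χ (a k) * _ = χ (a i) * _
  field_simp

theorem RowDetInvariance.succ_eq (hχ : χ (-1) = 1) {n : ℕ} (H : RowDetInvariance χ n) {ι : Type}
    [DecidableEq ι] (s : Finset ι) (A : ι → Fin (n + 1) → D) (hs : s.card = n + 1) {i : ι}
    (hi : i ∈ s) (hAi : A i (Fin.last n) ≠ 0) :
    rowDet χ (n + 1) s A =
      χ (A i (Fin.last n)) * rowDet χ n (s.erase i) (pivotReduce A i) := by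
  have h : ∃ i ∈ s, A i (Fin.last n) ≠ 0 := ⟨i, hi, hAi⟩
  rw [rowDet, dif_pos h]
  by_cases hik : i = h.choose
  · rw [← hik]
  · exact H.pivot_eq χ hχ s A hs hi h.choose_spec.1 hik hAi h.choose_spec.2

theorem RowDetInvariance.succ_add (hχ : χ (-1) = 1) {n : ℕ} (H : RowDetInvariance χ n) {ι : Type}
    [DecidableEq ι] (s : Finset ι) (A : ι → Fin (n + 1) → D) (c : ι → D) (j : ι)
    (hs : s.card = n + 1) (hj : j ∈ s) (hc : c j = 0) :
    rowDet χ (n + 1) s (fun i k => A i k + c i * A j k) = rowDet χ (n + 1) s A := by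
  by_cases hAj : A j (Fin.last n) = 0
  · by_cases h : ∃ i ∈ s, A i (Fin.last n) ≠ 0
    · obtain ⟨i, hi, hAi⟩ := h
      have hij : j ≠ i := fun e => hAi (e ▸ hAj)
      rw [H.succ_eq χ hχ s A hs hi hAi, H.succ_eq χ hχ s _ hs hi (by simpa [hAj] using hAi)]
      have hcard : (s.erase i).card = n := by rw [Finset.card_erase_of_mem hi, hs]; rfl
      simp only [hAj, mul_zero, add_zero]
      congr 1
      -- Row `j` has last entry 0, so it is its own reduction; the two reduced families differ by
      -- multiples of it.
      rw [← H.add (s.erase i) (pivotReduce A i)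
        (fun l => c l - A l (Fin.last n) * (A i (Fin.last n))⁻¹ * c i) j hcard
        (Finset.mem_erase.2 ⟨hij, hj⟩) (by simp [hc, hAj])]
      congr 1
      funext l k
      simp only [pivotReduce, hAj, mul_zero, add_zero, zero_mul, sub_zero, mul_add, sub_mul,
        mul_assoc]
      abel
    · push Not at h
      rw [rowDet_succ_of_forall_eq_zero χ h, rowDet_succ_of_forall_eq_zero χ]
      intro i hi
      rw [h i hi, hAj, mul_zero, add_zero]
  -- With row `j` as pivot, the added multiples of row `j` are cleared again and the reduced rows
  -- coincide.
  · rw [H.succ_eq χ hχ s A hs hj hAj,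
      H.succ_eq χ hχ s _ hs hj (by simpa [hc] using hAj)]
    simp only [hc, zero_mul, add_zero]
    congr 2
    funext l k
    simp only [pivotReduce, hc, zero_mul, add_zero, add_mul, mul_assoc,
      mul_inv_cancel_left₀ hAj]
    abel

theorem RowDetInvariance.succ_scale (hχ : χ (-1) = 1) {n : ℕ} (H : RowDetInvariance χ n) {ι : Type}
    [DecidableEq ι] (s : Finset ι) (A : ι → Fin (n + 1) → D) (x : ι → D)
    (hs : s.card = n + 1) (hx : ∀ i ∈ s, x i ≠ 0) :
    rowDet χ (n + 1) s (fun i k => x i * A i k) = (∏ i ∈ s, χ (x i)) * rowDet χ (n + 1) s A := by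
  by_cases h : ∃ i ∈ s, A i (Fin.last n) ≠ 0
  · obtain ⟨i, hi, hAi⟩ := h
    have hcard : (s.erase i).card = n := by rw [Finset.card_erase_of_mem hi, hs]; rfl
    rw [H.succ_eq χ hχ s A hs hi hAi, H.succ_eq χ hχ s _ hs hi (mul_ne_zero (hx i hi) hAi)]
    have : pivotReduce (fun i k => x i * A i k) i = fun j k => x j * pivotReduce A i j k := by
      funext j k
      simp only [pivotReduce, mul_sub, mul_inv_rev, mul_assoc, inv_mul_cancel_left₀ (hx i hi)]
    rw [this, H.scale (s.erase i) _ x hcard (fun j hj => hx j (Finset.mem_of_mem_erase hj)),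
      ← Finset.mul_prod_erase s _ hi, map_mul]
    ac_rfl
  · push Not at h
    rw [rowDet_succ_of_forall_eq_zero χ h, rowDet_succ_of_forall_eq_zero χ, mul_zero]
    intro i hi
    rw [h i hi, mul_zero]

theorem RowDetInvariance.succ_map (hχ : χ (-1) = 1) {n : ℕ} (H : RowDetInvariance χ n)
    {ι κ : Type} [DecidableEq ι] [DecidableEq κ] (s : Finset ι) (e : ι ↪ κ)
    (A : ι → Fin (n + 1) → D) (B : κ → Fin (n + 1) → D) (hs : s.card = n + 1)
    (hB : ∀ i ∈ s, B (e i) = A i) :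
    rowDet χ (n + 1) (s.map e) B = rowDet χ (n + 1) s A := by
  by_cases h : ∃ i ∈ s, A i (Fin.last n) ≠ 0
  · obtain ⟨i, hi, hAi⟩ := h
    have hcard : (s.erase i).card = n := by rw [Finset.card_erase_of_mem hi, hs]; rfl
    rw [H.succ_eq χ hχ s A hs hi hAi, H.succ_eq χ hχ (s.map e) B (by rw [Finset.card_map, hs])
      (Finset.mem_map_of_mem e hi) (by rwa [hB i hi]), hB i hi, ← Finset.map_erase,
      H.map (s.erase i) e (pivotReduce A i) _ hcard]
    intro j hj
    funext k
    simp only [pivotReduce, hB i hi, hB j (Finset.mem_of_mem_erase hj)]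
  · push Not at h
    rw [rowDet_succ_of_forall_eq_zero χ h, rowDet_succ_of_forall_eq_zero χ]
    intro j hj
    obtain ⟨i, hi, rfl⟩ := Finset.mem_map.1 hj
    rw [hB i hi, h i hi]

/-- The three properties must be proved together: each in size `n + 1` needs a free choice of pivot,
and that freedom uses all three in size `n`. -/
theorem rowDetInvariance (hχ : χ (-1) = 1) (n : ℕ) : RowDetInvariance χ n := by
  induction n with
  | zero =>
    refine ⟨fun _ _ _ _ _ _ _ => rfl, fun s A x hs _ => ?_, fun _ _ _ _ _ _ => rfl⟩
    rw [Finset.card_eq_zero.1 hs, Finset.prod_empty, one_mul]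
    rfl
  | succ n H => exact ⟨H.succ_add χ hχ, H.succ_scale χ hχ, H.succ_map χ hχ⟩

theorem rowDet_succ_of_pivot (hχ : χ (-1) = 1) {n : ℕ} {ι : Type} [DecidableEq ι] (s : Finset ι)
    (A : ι → Fin (n + 1) → D) (hs : s.card = n + 1) {i : ι} (hi : i ∈ s)
    (hAi : A i (Fin.last n) ≠ 0) :
    rowDet χ (n + 1) s A =
      χ (A i (Fin.last n)) * rowDet χ n (s.erase i) (pivotReduce A i) :=
  (rowDetInvariance χ hχ n).succ_eq χ hχ s A hs hi hAi

end RowDet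
-- Generation of GL by row additions and diagonal matrices
section Generation
variable {D : Type*} [Ring D] {n : Type} [DecidableEq n]

/-- The matrix whose left multiplication adds `c i` times the row `j` to the row `i`, for all
`i`. -/
def rowAddMatrix (j : n) (c : n → D) : Matrix n n D :=
  1 + Matrix.of fun i k => if k = j then c i else 0

theorem rowAddMatrix_apply (j : n) (c : n → D) (i k : n) :
    rowAddMatrix j c i k = (1 : Matrix n n D) i k + if k = j then c i else 0 := rfl

variable [Fintype n]

theorem rowAddMatrix_mul_apply (j : n) (c : n → D) (A : Matrix n n D) (i k : n) :
    (rowAddMatrix j c * A) i k = A i k + c i * A j k := by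
  simp [rowAddMatrix, add_mul, Matrix.mul_apply, Matrix.add_apply, Finset.sum_add_distrib,
    Matrix.one_apply]

theorem rowAddMatrix_mul_neg (j : n) (c : n → D) (hc : c j = 0) :
    rowAddMatrix j c * rowAddMatrix j (-c) = 1 := by
  ext i k
  rw [rowAddMatrix_mul_apply]
  rcases eq_or_ne k j with rfl | h
  · simp [rowAddMatrix_apply, hc]
  · simp [rowAddMatrix_apply, h, Matrix.one_apply_ne h.symm]

/-- The invertible matrix `rowAddMatrix j c` for `c j = 0`. -/
def rowAdd (j : n) (c : n → D) (hc : c j = 0) : (Matrix n n D)ˣ where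
  val := rowAddMatrix j c
  inv := rowAddMatrix j (-c)
  val_inv := rowAddMatrix_mul_neg j c hc
  inv_val := by
    have h := rowAddMatrix_mul_neg j (-c) (by simp [hc])
    rwa [neg_neg] at h

/-- The invertible diagonal matrices. -/
def diagonalUnits : (n → Dˣ) →* (Matrix n n D)ˣ where
  toFun x :=
    { val := Matrix.diagonal fun i => (x i : D)
      inv := Matrix.diagonal fun i => ((x i)⁻¹ : Dˣ)
      val_inv := by simp
      inv_val := by simp }
  map_one' := by ext1; simp
  map_mul' x y := by ext1; simp

/-- Rearranged, this exhibits `rowAdd j c` as a commutator, provided there is an index `l ≠ j` with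
`c l = 0`. -/
theorem rowAdd_mul_rowAdd_mul_rowAdd {j l : n} (hjl : j ≠ l) (c : n → D) (hj : c j = 0)
    (hl : c l = 0) (h : (Pi.single l 1 : n → D) j = 0) :
    rowAdd j c hj * (rowAdd j (Pi.single l 1) h * rowAdd l c hl) =
      rowAdd l c hl * rowAdd j (Pi.single l 1) h := by
  ext i k
  simp only [rowAdd, Units.val_mul, rowAddMatrix_mul_apply, rowAddMatrix_apply, hj, h,
    Matrix.one_apply]
  rcases eq_or_ne k j with rfl | hk
  · simp [hjl, hjl.symm]
  · simp [hk, Ne.symm hk, eq_comm]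

end Generation

section
variable {D : Type*} [DivisionRing D] {n : Type} [Fintype n] [DecidableEq n]

theorem exists_apply_ne_zero_of_isUnit (M : (Matrix n n D)ˣ) {t : Finset n} {j : n} (hj : j ∉ t)
    (ht : ∀ k ∈ t, ∀ i, M.val i k = (1 : Matrix n n D) i k) : ∃ i ∉ t, M.val i j ≠ 0 := by
  by_contra! h
  -- If column `j` vanished outside `t`, it would be a combination of the unit columns indexed by
  -- `t`; `v` records this relation and lies in the kernel.
  let v : n → D := fun k => if k = j then 1 else if k ∈ t then -M.val k j else 0
  have hv : M.val.mulVec v = 0 := by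
    funext i
    rw [Matrix.mulVec, dotProduct, ← Finset.add_sum_erase _ _ (Finset.mem_univ j)]
    have : ∀ k ∈ Finset.univ.erase j, M.val i k * v k =
        if k = i then (if i ∈ t then - M.val i j else 0) else 0 := by
      intro k hk
      have hkj : k ≠ j := (Finset.mem_erase.1 hk).1
      by_cases hkt : k ∈ t
      · rw [ht k hkt]
        rcases eq_or_ne k i with rfl | hki
        · simp [v, hkj, hkt]
        · simp [hki, Matrix.one_apply_ne hki.symm]
      · rcases eq_or_ne k i with rfl | hki
        · simp [v, hkj, hkt]
        · simp [v, hkj, hkt, hki]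
    rw [Finset.sum_congr rfl this, Finset.sum_ite_eq']
    by_cases hit : i ∈ t
    · have hij : i ≠ j := fun e => hj (e ▸ hit)
      simp [v, hit, hij]
    · simp [v, hit, h i hit]
  have h1 : v = 0 := by
    have h2 := congrArg (M⁻¹).val.mulVec hv
    rwa [Matrix.mulVec_mulVec, Units.inv_mul, Matrix.one_mulVec, Matrix.mulVec_zero] at h2
  have h3 : v j = 0 := congrFun h1 j
  simp [v] at h3

theorem exists_mem_mul_apply_eq_one {H : Subgroup (Matrix n n D)ˣ}
    (hA : ∀ j c (hc : c j = 0), rowAdd j c hc ∈ H) (hD : ∀ x, diagonalUnits x ∈ H)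
    (M : (Matrix n n D)ˣ) {t : Finset n} {j : n} (hj : j ∉ t)
    (ht : ∀ k ∈ t, ∀ i, M.val i k = (1 : Matrix n n D) i k) :
    ∃ g ∈ H, (g * M).val j j = 1 ∧ ∀ k ∈ t, ∀ i, (g * M).val i k = (1 : Matrix n n D) i k := by
  obtain ⟨i, hi, hij⟩ := exists_apply_ne_zero_of_isUnit M hj ht
  have hne : ∀ k ∈ t, ∀ l ∉ t, M.val l k = 0 := fun k hk l hl => by
    rw [ht k hk, Matrix.one_apply_ne (by rintro rfl; exact hl hk)]
  rcases eq_or_ne i j with rfl | hne'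
  · refine ⟨_, hD (Pi.mulSingle i (Units.mk0 _ hij)⁻¹), ?_, fun k hk l => ?_⟩
    · simp [diagonalUnits, hij]
    · rcases eq_or_ne l i with rfl | hl
      · simp [diagonalUnits, hne k hk l hj, ← ht k hk]
      · simp [diagonalUnits, hl, ← ht k hk]
  -- Adding a multiple of row `i` to row `j` creates the entry 1 without a permutation matrix. Row
  -- `i` is zero in the columns of `t`, so these are preserved.
  · refine ⟨_, hA i (Pi.single j ((1 - M.val j j) * (M.val i j)⁻¹)) (by simp [hne']), ?_,
      fun k hk l => ?_⟩
    · simp [rowAdd, rowAddMatrix_mul_apply, hij]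
    · simp [rowAdd, rowAddMatrix_mul_apply, hne k hk i hi, ← ht k hk]

/-- Gauss–Jordan elimination: the columns are turned into unit columns one at a time, without
disturbing those already treated. -/
theorem mem_of_rowAdd_mem_of_diagonal_mem {H : Subgroup (Matrix n n D)ˣ}
    (hA : ∀ j c (hc : c j = 0), rowAdd j c hc ∈ H) (hD : ∀ x, diagonalUnits x ∈ H)
    (B : (Matrix n n D)ˣ) : B ∈ H := by
  have key : ∀ t : Finset n, ∃ g ∈ H, ∀ k ∈ t, ∀ i, (g * B).val i k = (1 : Matrix n n D) i k := by
    intro t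
    induction t using Finset.induction_on with
    | empty => exact ⟨1, H.one_mem, by simp⟩
    | insert j t hj ih =>
      obtain ⟨g, hg, h⟩ := ih
      obtain ⟨g', hg', h1, h2⟩ := exists_mem_mul_apply_eq_one hA hD (g * B) hj h
      set M := g' * (g * B) with hM
      let c : n → D := fun i => if i = j then 0 else -M.val i j
      refine ⟨rowAdd j c (if_pos rfl) * g' * g,
        H.mul_mem (H.mul_mem (hA _ _ _) hg') hg, fun k hk i => ?_⟩
      rw [mul_assoc, mul_assoc, ← hM, Units.val_mul, rowAdd, rowAddMatrix_mul_apply]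
      rcases Finset.mem_insert.1 hk with rfl | hk
      · rw [h1, mul_one]
        rcases eq_or_ne i k with rfl | hik
        · simp [c, h1]
        · simp [c, hik]
      · have hjk : j ≠ k := fun e => hj (e ▸ hk)
        rw [h2 k hk i, h2 k hk j, Matrix.one_apply_ne hjk, mul_zero, add_zero]
  obtain ⟨g, hg, h⟩ := key Finset.univ
  have : g * B = 1 := by
    ext i k
    exact h k (Finset.mem_univ k) i
  rw [← inv_eq_of_mul_eq_one_right this]
  exact H.inv_mem hg

end

/-! ### The Dieudonné determinant on K₁ -/

section K₁
variable {D G : Type*} [DivisionRing D] [CommGroupWithZero G]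

theorem K₁.ofGL_stabilize (n k : ℕ) (hnk : n ≤ k) (A : (Matrix (Fin n) (Fin n) D)ˣ) :
    K₁.ofGL D k (stabilize D n k hnk A) = K₁.ofGL D n A :=
  congrArg Abelianization.of (DirectLimit.mk_apply (f := stabilize D) n k A hnk)

/-- One stabilization step supplies the spare index needed to write the row addition as a
commutator. -/
theorem K₁.ofGL_rowAdd (n : ℕ) (j : Fin n) (c : Fin n → D) (hc : c j = 0) :
    K₁.ofGL D n (rowAdd j c hc) = 1 := by
  rw [← K₁.ofGL_stabilize n (n + 1) n.le_succ]
  let c' : Fin (n + 1) → D := Fin.lastCases 0 c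
  have hj : c' j.castSucc = 0 := by simp [c', hc]
  have hl : c' (Fin.last n) = 0 := by simp [c']
  have hjl : j.castSucc ≠ Fin.last n := j.castSucc_ne_last
  have h : stabilize D n (n + 1) n.le_succ (rowAdd j c hc) = rowAdd j.castSucc c' hj := by
    ext i k
    simp only [stabilize, rowAdd, Units.coe_map, MonoidHom.coe_mk, OneHom.coe_mk, extendMatrix,
      rowAddMatrix_apply]
    induction i using Fin.lastCases with
    | last => simp [c', Matrix.one_apply]
    | cast i =>
      induction k using Fin.lastCases with
      | last => simp [hjl.symm]
      | cast k => simp [c', Matrix.one_apply]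
  have h2 := congrArg (K₁.ofGL D (n + 1)) (rowAdd_mul_rowAdd_mul_rowAdd hjl c' hj hl
    (Pi.single_eq_of_ne hjl _))
  rw [h]
  simp only [map_mul] at h2
  rw [mul_comm (K₁.ofGL D (n + 1) (rowAdd (Fin.last n) c' hl))] at h2
  exact mul_eq_right.1 h2

theorem K₁.ofUnits_of (d : Dˣ) : K₁.ofUnits D (Abelianization.of d) =
    K₁.ofGL D 1 (Units.map (Matrix.scalar (Fin 1) : D →+* _) d) := rfl

/-- The invertible permutation matrix of a transposition. -/
def swapUnit {n : Type} [Fintype n] [DecidableEq n] (i j : n) : (Matrix n n D)ˣ where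
  val := (Equiv.swap i j).permMatrix D
  inv := (Equiv.swap i j).permMatrix D
  val_inv := by rw [← Matrix.permMatrix_mul, Equiv.swap_mul_self, Matrix.permMatrix_one]
  inv_val := by rw [← Matrix.permMatrix_mul, Equiv.swap_mul_self, Matrix.permMatrix_one]

/-- Conjugation by a transposition matrix moves the entry to index 0 and is invisible in K₁; the
result is a stabilized 1 × 1 matrix. -/
theorem K₁.ofGL_diagonal_mulSingle (n : ℕ) (i : Fin n) (x : Dˣ) :
    K₁.ofGL D n (diagonalUnits (Pi.mulSingle i x)) = K₁.ofUnits D (Abelianization.of x) := by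
  obtain ⟨n, rfl⟩ : ∃ k, n = k + 1 := ⟨n - 1, by have := i.pos; omega⟩
  have h0 : K₁.ofGL D (n + 1) (diagonalUnits (Pi.mulSingle i x)) =
      K₁.ofGL D (n + 1) (diagonalUnits (Pi.mulSingle 0 x)) := by
    have h : swapUnit 0 i * diagonalUnits (Pi.mulSingle i x) =
        diagonalUnits (Pi.mulSingle 0 x) * (swapUnit 0 i : (Matrix _ _ D)ˣ) := by
      ext r s
      simp only [swapUnit, diagonalUnits, Units.val_mul, MonoidHom.coe_mk, OneHom.coe_mk,
        Matrix.mul_diagonal, Matrix.diagonal_mul, Equiv.Perm.permMatrix, PEquiv.toMatrix_apply,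
        Equiv.toPEquiv_apply, Option.mem_some_iff]
      split_ifs with h
      · subst h
        rw [one_mul, mul_one]
        congr 1
        rcases eq_or_ne r 0 with rfl | hr
        · simp
        rcases eq_or_ne r i with rfl | hri
        · rw [Equiv.swap_apply_right, Pi.mulSingle_eq_of_ne hr, Pi.mulSingle_eq_of_ne hr.symm]
        · rw [Equiv.swap_apply_of_ne_of_ne hr hri, Pi.mulSingle_eq_of_ne hr,
            Pi.mulSingle_eq_of_ne hri]
      · simp
    have h' := congrArg (K₁.ofGL D (n + 1)) h
    rw [map_mul, map_mul, mul_comm] at h'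
    exact mul_right_cancel h'
  rw [h0, K₁.ofUnits_of, ← K₁.ofGL_stabilize 1 (n + 1) (by omega)]
  congr 1
  ext r s
  simp only [stabilize, diagonalUnits, Units.coe_map, MonoidHom.coe_mk, OneHom.coe_mk,
    extendMatrix, Matrix.diagonal_apply]
  rcases eq_or_ne r 0 with rfl | hr
  · rcases eq_or_ne s 0 with rfl | hs
    · simp
    · have : s.val ≠ 0 := fun h => hs (Fin.ext h)
      simp [hs.symm, this]
  · have : r.val ≠ 0 := fun h => hr (Fin.ext h)
    simp [hr, this]

/-- Existence of the Dieudonné determinant: row additions die in K₁ and diagonal matrices are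
products of single-entry ones. Injectivity is not needed, since `K₁.det` assigns equal values to all
representatives. -/
theorem K₁.ofUnits_surjective (D : Type*) [DivisionRing D] :
    Function.Surjective (K₁.ofUnits D) := by
  intro τ
  obtain ⟨a, rfl⟩ := QuotientGroup.mk_surjective τ
  obtain ⟨n, A, rfl⟩ := DirectLimit.exists_eq_mk (f := stabilize D) a
  refine mem_of_rowAdd_mem_of_diagonal_mem (H := (K₁.ofUnits D).range.comap (K₁.ofGL D n))
    (fun j c hc => ?_) (fun x => ?_) A
  · rw [Subgroup.mem_comap, K₁.ofGL_rowAdd]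
    exact one_mem _
  · refine Subgroup.pi_mem_of_mulSingle_mem
      (H := ((K₁.ofUnits D).range.comap (K₁.ofGL D n)).comap diagonalUnits) x fun i => ?_
    rw [Subgroup.mem_comap, Subgroup.mem_comap, K₁.ofGL_diagonal_mulSingle]
    exact ⟨_, rfl⟩

variable (χ : D →*₀ G)

/-- The value under `χ` of the Dieudonné determinant of a square matrix, if `χ (-1) = 1`. -/
noncomputable def matrixDet (n : ℕ) (A : Matrix (Fin n) (Fin n) D) : G :=
  rowDet χ n Finset.univ fun i k => A i k

theorem matrixDet_extendMatrix (hχ : χ (-1) = 1) (n : ℕ) (A : Matrix (Fin n) (Fin n) D) :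
    matrixDet χ (n + 1) (extendMatrix A : Matrix (Fin (n + 1)) (Fin (n + 1)) D) =
      matrixDet χ n A := by
  have hl : (extendMatrix A : Matrix (Fin (n + 1)) (Fin (n + 1)) D) (Fin.last n) (Fin.last n) = 1 :=
    by simp [extendMatrix]
  have he : (Finset.univ : Finset (Fin (n + 1))).erase (Fin.last n) =
      Finset.univ.map Fin.castSuccEmb := by
    ext i
    induction i using Fin.lastCases <;> simp
  rw [matrixDet, rowDet_succ_of_pivot χ hχ _ _ (by simp) (Finset.mem_univ (Fin.last n))
    (by rw [hl]; exact one_ne_zero), hl, map_one, one_mul, he]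
  refine (rowDetInvariance χ hχ n).map _ _ _ _ (by simp) fun i _ => ?_
  funext k
  simp [pivotReduce, extendMatrix, (Fin.castSucc_ne_last i)]

theorem matrixDet_one (hχ : χ (-1) = 1) (n : ℕ) :
    matrixDet χ n (1 : Matrix (Fin n) (Fin n) D) = 1 := by
  induction n with
  | zero => rfl
  | succ n ih => rw [← extendMatrix_one, matrixDet_extendMatrix χ hχ n, ih]

/-- The matrices that act by a constant factor form a subgroup containing the generators. Evaluating
at the identity matrix then identifies the factor, which gives multiplicativity. -/
theorem exists_matrixDet_mul (hχ : χ (-1) = 1) (n : ℕ) (g : (Matrix (Fin n) (Fin n) D)ˣ) :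
    ∃ u : Gˣ, ∀ A : Matrix (Fin n) (Fin n) D,
      matrixDet χ n (g.val * A) = u * matrixDet χ n A := by
  let H : Subgroup (Matrix (Fin n) (Fin n) D)ˣ :=
    { carrier := {g | ∃ u : Gˣ, ∀ A : Matrix (Fin n) (Fin n) D,
        matrixDet χ n (g.val * A) = u * matrixDet χ n A}
      mul_mem' := by
        rintro g h ⟨u, hu⟩ ⟨v, hv⟩
        exact ⟨u * v, fun A => by rw [Units.val_mul, mul_assoc, hu, hv, Units.val_mul, mul_assoc]⟩
      one_mem' := ⟨1, fun A => by simp⟩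
      inv_mem' := by
        rintro g ⟨u, hu⟩
        exact ⟨u⁻¹, fun A => by rw [Units.eq_inv_mul_iff_mul_eq, ← hu, Units.mul_inv_cancel_left]⟩ }
  refine mem_of_rowAdd_mem_of_diagonal_mem (H := H) (fun j c hc => ⟨1, fun A => ?_⟩)
    (fun x => ⟨∏ i, Units.map (χ : D →* G) (x i), fun A => ?_⟩) g
  · rw [Units.val_one, one_mul, matrixDet, matrixDet,
      ← (rowDetInvariance χ hχ n).add Finset.univ (fun i k => A i k) c j (by simp)
        (Finset.mem_univ j) hc]
    congr 1
    funext i k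
    exact rowAddMatrix_mul_apply j c A i k
  · rw [Units.coe_prod]
    refine Eq.trans ?_ ((rowDetInvariance χ hχ n).scale Finset.univ (fun i k => A i k)
      (fun i => (x i : D)) (by simp) (fun i _ => (x i).ne_zero))
    congr 1
    funext i k
    exact Matrix.diagonal_mul _ _ _ _

theorem matrixDet_mul (hχ : χ (-1) = 1) (n : ℕ) (g : (Matrix (Fin n) (Fin n) D)ˣ)
    (A : Matrix (Fin n) (Fin n) D) : matrixDet χ n (g.val * A) =
      matrixDet χ n g.val * matrixDet χ n A := by
  obtain ⟨u, hu⟩ := exists_matrixDet_mul χ hχ n g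
  have h := hu 1
  rw [mul_one, matrixDet_one χ hχ, mul_one] at h
  rw [hu, h]

/-- The homomorphism `GL(D, n) → Gˣ` obtained from the Dieudonné determinant and `χ`. -/
noncomputable def rowDetHom (hχ : χ (-1) = 1) (n : ℕ) : (Matrix (Fin n) (Fin n) D)ˣ →* Gˣ :=
  MonoidHom.toHomUnits
    { toFun := fun A => matrixDet χ n A.val
      map_one' := matrixDet_one χ hχ n
      map_mul' := fun A B => matrixDet_mul χ hχ n A B.val }

theorem rowDetHom_stabilize (hχ : χ (-1) = 1) (n k : ℕ) (hnk : n ≤ k)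
    (A : (Matrix (Fin n) (Fin n) D)ˣ) :
    rowDetHom χ hχ n A = rowDetHom χ hχ k (stabilize D n k hnk A) := by
  induction k, hnk using Nat.le_induction with
  | base => rw [DirectedSystem.map_self' (stabilize D)]
  | succ k hnk ih =>
    rw [ih, ← DirectedSystem.map_map' (stabilize D) hnk k.le_succ]
    exact Units.ext (matrixDet_extendMatrix χ hχ k _).symm

/-- The homomorphism `K₁(D) → Gˣ` obtained from the Dieudonné determinant and `χ`. -/
noncomputable def K₁.det (hχ : χ (-1) = 1) : K₁ D →* Gˣ :=
  Abelianization.lift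
    { toFun := DirectLimit.lift (stabilize D) (fun n A => rowDetHom χ hχ n A)
        (rowDetHom_stabilize χ hχ)
      map_one' := DirectLimit.lift_one _ _
      map_mul' := DirectLimit.lift_mul _ _ }

theorem K₁.det_ofGL (hχ : χ (-1) = 1) (n : ℕ) (A : (Matrix (Fin n) (Fin n) D)ˣ) :
    (K₁.det χ hχ (K₁.ofGL D n A) : G) = matrixDet χ n A.val := rfl

theorem K₁.det_ofUnits (hχ : χ (-1) = 1) (d : Dˣ) :
    (K₁.det χ hχ (K₁.ofUnits D (Abelianization.of d)) : G) = χ d := by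
  rw [K₁.ofUnits_of, K₁.det_ofGL]
  refine (rowDet_succ_of_pivot χ hχ _ _ rfl (Finset.mem_univ (Fin.last 0)) ?_).trans ?_
  · simp
  · simp [rowDet]

end K₁
-- Homogeneous components, supports and leading parts
section Components
variable {K R : Type*} [DivisionRing K] [Ring R] [Module K R] [IsScalarTower K R R] {m : ℕ}
  (V : (Fin m → ℤ) → Submodule K R) [hV : IsSkewLaurentGrading V]

theorem component_add (f g : R) (α : Fin m → ℤ) :
    component V (f + g) α = component V f α + component V g α := by
  let := hV.isInternal.chooseDecomposition
  exact congrArg (fun x : DirectSum _ (fun α => V α) => (x α : R)) (DirectSum.decompose_add V f g)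

theorem component_of_mem {α : Fin m → ℤ} {f : R} (hf : f ∈ V α) (β : Fin m → ℤ) :
    component V f β = if α = β then f else 0 := by
  let := hV.isInternal.chooseDecomposition
  split_ifs with h
  · subst h
    exact DirectSum.decompose_of_mem_same V hf
  · exact DirectSum.decompose_of_mem_ne V hf h

theorem component_mem (f : R) (α : Fin m → ℤ) : component V f α ∈ V α := Subtype.prop _

/-- The map `f ↦ component V f α` as a homomorphism of additive groups. -/
noncomputable def componentHom (α : Fin m → ℤ) : R →+ R :=
  AddMonoidHom.mk' (component V · α) fun f g => component_add V f g α

theorem component_zero (α : Fin m → ℤ) : component V 0 α = 0 := (componentHom V α).map_zero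

theorem component_neg (f : R) (α : Fin m → ℤ) : component V (-f) α = -component V f α :=
  (componentHom V α).map_neg f

theorem component_sum {ι : Type*} (s : Finset ι) (f : ι → R) (α : Fin m → ℤ) :
    component V (∑ i ∈ s, f i) α = ∑ i ∈ s, component V (f i) α :=
  map_sum (componentHom V α) f s

theorem exists_eq_sum_component (f : R) :
    ∃ s : Finset (Fin m → ℤ), (s : Set (Fin m → ℤ)) = support V f ∧
      f = ∑ α ∈ s, component V f α := by
  classical
  let := hV.isInternal.chooseDecomposition
  refine ⟨(DirectSum.decompose V f).support, ?_, (DirectSum.sum_support_decompose V f).symm⟩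
  ext α
  rw [Finset.mem_coe, DFinsupp.mem_support_iff, Ne, ← Submodule.coe_eq_zero]
  rfl

theorem support_finite (f : R) : (support V f).Finite := by
  obtain ⟨s, hs, -⟩ := exists_eq_sum_component V f
  exact hs ▸ s.finite_toSet

theorem ext_component {f g : R} (h : ∀ α, component V f α = component V g α) : f = g := by
  obtain ⟨s, -, hf⟩ := exists_eq_sum_component V (f - g)
  rw [← sub_eq_zero, hf]
  refine Finset.sum_eq_zero fun α _ => ?_
  rw [sub_eq_add_neg, component_add, component_neg, h, add_neg_cancel]

theorem support_nonempty {f : R} (hf : f ≠ 0) : (support V f).Nonempty := by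
  by_contra h
  rw [Set.not_nonempty_iff_eq_empty, Set.eq_empty_iff_forall_notMem] at h
  exact hf (ext_component V fun α => by rw [component_zero]; exact not_not.1 (h α))

theorem support_add {f g : R} {α : Fin m → ℤ} (h : α ∈ support V (f + g)) :
    α ∈ support V f ∨ α ∈ support V g := by
  by_contra! hn
  refine h ?_
  rw [component_add, not_not.1 hn.1, not_not.1 hn.2, add_zero]

theorem support_neg (f : R) : support V (-f) = support V f := by
  ext α
  simp [support, component_neg]

theorem support_mul {f g : R} {γ : Fin m → ℤ} (h : γ ∈ support V (f * g)) :
    ∃ α ∈ support V f, ∃ β ∈ support V g, α + β = γ := by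
  obtain ⟨s, hs, hf⟩ := exists_eq_sum_component V f
  obtain ⟨t, ht, hg⟩ := exists_eq_sum_component V g
  have h' : component V (f * g) γ ≠ 0 := h
  rw [hf, hg, Finset.sum_mul_sum, component_sum] at h'
  obtain ⟨α, hα, h'⟩ := Finset.exists_ne_zero_of_sum_ne_zero h'
  rw [component_sum] at h'
  obtain ⟨β, hβ, h'⟩ := Finset.exists_ne_zero_of_sum_ne_zero h'
  refine ⟨α, hs ▸ hα, β, ht ▸ hβ, ?_⟩
  by_contra hn
  rw [component_of_mem V ((gradedMonoid V).mul_mem (component_mem V f α) (component_mem V g β)),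
    if_neg hn] at h'
  exact h' rfl

theorem support_one : support V (1 : R) ⊆ {0} := by
  intro α hα
  by_contra h
  refine hα ?_
  rw [component_of_mem V (gradedMonoid V).one_mem, if_neg (Ne.symm h)]

theorem exists_ne_zero_mem (α : Fin m → ℤ) : ∃ t ∈ V α, t ≠ 0 := by
  have : Nontrivial (V α) := Module.nontrivial_of_finrank_eq_succ (hV.finrank_eq_one α)
  obtain ⟨t, ht⟩ := exists_ne (0 : V α)
  exact ⟨t, t.2, fun h => ht (Subtype.ext h)⟩

section Parts
variable {M : Type*} [AddCommGroup M] (deg : (Fin m → ℤ) →+ M)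

/-- All exponents which occur in `f` have degree `k`. -/
def IsHomogeneous (k : M) (f : R) : Prop := ∀ α ∈ support V f, deg α = k

/-- The part of degree `k` of `f`. -/
noncomputable def part (k : M) (f : R) : R :=
  ∑ᶠ α ∈ {α : Fin m → ℤ | deg α = k}, component V f α

open Classical in
theorem component_part (k : M) (f : R) (α : Fin m → ℤ) :
    component V (part V deg k f) α = if deg α = k then component V f α else 0 := by
  obtain ⟨s, hs, -⟩ := exists_eq_sum_component V f
  have h : part V deg k f = ∑ β ∈ s with deg β = k, component V f β := by
    rw [part, finsum_mem_eq_sum_of_inter_support_eq]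
    ext β
    simp only [Set.mem_inter_iff, Function.mem_support, Finset.coe_filter, Set.mem_ofPred_eq,
      and_congr_left_iff]
    intro hβ
    have : β ∈ (s : Set (Fin m → ℤ)) := hs ▸ hβ
    exact ⟨fun h => ⟨this, h⟩, fun h => h.2⟩
  rw [h, component_sum]
  simp only [component_of_mem V (component_mem V f _), Finset.sum_ite_eq', Finset.mem_filter]
  by_cases hα : α ∈ s
  · simp [hα]
  · have : component V f α = 0 := by
      have : α ∉ support V f := by rwa [← hs]
      exact not_not.1 this
    simp [hα, this]

theorem isHomogeneous_part (k : M) (f : R) : IsHomogeneous V deg k (part V deg k f) := by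
  intro α hα
  by_contra h
  refine hα ?_
  rw [component_part, if_neg h]

theorem part_add (k : M) (f g : R) :
    part V deg k (f + g) = part V deg k f + part V deg k g := by
  classical
  refine ext_component V fun α => ?_
  simp only [component_add, component_part]
  split_ifs <;> simp

theorem part_eq_self {k : M} {f : R} (h : IsHomogeneous V deg k f) : part V deg k f = f := by
  classical
  refine ext_component V fun α => ?_
  rw [component_part]
  split_ifs with hα
  · rfl
  · by_contra hn
    exact hα (h α (Ne.symm hn))

theorem part_eq_zero {k : M} {f : R} (h : ∀ α ∈ support V f, deg α ≠ k) :
    part V deg k f = 0 := by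
  classical
  refine ext_component V fun α => ?_
  rw [component_part, component_zero]
  split_ifs with hα
  · by_contra hn
    exact h α hn hα
  · rfl

theorem part_ne_zero {f : R} {α : Fin m → ℤ} (hα : α ∈ support V f) :
    part V deg (deg α) f ≠ 0 := by
  classical
  intro h
  have := component_part V deg (deg α) f α
  rw [h, component_zero, if_pos rfl] at this
  exact hα this.symm

theorem support_sub_part {k : M} {f : R} {α : Fin m → ℤ}
    (hα : α ∈ support V (f - part V deg k f)) : α ∈ support V f ∧ deg α ≠ k := by
  classical
  have h : component V (f - part V deg k f) α ≠ 0 := hα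
  rw [sub_eq_add_neg, component_add, component_neg, component_part] at h
  split_ifs at h with hk
  · exact absurd (add_neg_cancel _) h
  · exact ⟨by rwa [neg_zero, add_zero] at h, hk⟩

variable {V deg}

theorem IsHomogeneous.mul {k l : M} {f g : R} (hf : IsHomogeneous V deg k f)
    (hg : IsHomogeneous V deg l g) : IsHomogeneous V deg (k + l) (f * g) := by
  intro γ hγ
  obtain ⟨α, hα, β, hβ, rfl⟩ := support_mul V hγ
  rw [map_add, hf α hα, hg β hβ]

theorem IsHomogeneous.one : IsHomogeneous V deg 0 (1 : R) := by
  intro α hα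
  rw [Set.mem_singleton_iff.1 (support_one V hα), map_zero]

theorem IsHomogeneous.of_mem {α : Fin m → ℤ} {f : R} (hf : f ∈ V α) :
    IsHomogeneous V deg (deg α) f := by
  intro β hβ
  by_contra h
  refine hβ ?_
  rw [component_of_mem V hf, if_neg]
  rintro rfl
  exact h rfl

theorem part_mul_of_isHomogeneous {l : M} {s : R} (hs : IsHomogeneous V deg l s) (k : M) (f : R) :
    part V deg (k + l) (f * s) = part V deg k f * s := by
  have h : f * s = part V deg k f * s + (f - part V deg k f) * s := by
    rw [← add_mul, add_sub_cancel]
  rw [h, part_add, part_eq_self V deg ((isHomogeneous_part V deg k f).mul hs),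
    part_eq_zero V deg (f := (f - _) * s), add_zero]
  intro γ hγ
  obtain ⟨α, hα, β, hβ, rfl⟩ := support_mul V hγ
  rw [map_add, hs β hβ, Ne, add_left_inj]
  exact (support_sub_part V deg hα).2

theorem part_isHomogeneous_mul {l : M} {s : R} (hs : IsHomogeneous V deg l s) (k : M) (f : R) :
    part V deg (l + k) (s * f) = s * part V deg k f := by
  have h : s * f = s * part V deg k f + s * (f - part V deg k f) := by
    rw [← mul_add, add_sub_cancel]
  rw [h, part_add, part_eq_self V deg (hs.mul (isHomogeneous_part V deg k f)),
    part_eq_zero V deg (f := s * (f - _)), add_zero]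
  intro γ hγ
  obtain ⟨α, hα, β, hβ, rfl⟩ := support_mul V hγ
  rw [map_add, hs α hα, Ne, add_right_inj]
  exact (support_sub_part V deg hβ).2

end Parts

section Top
variable {M : Type*} [AddCommGroup M] [ConditionallyCompleteLinearOrder M]
  (deg : (Fin m → ℤ) →+ M)

/-- The largest degree of an exponent which occurs in `f`. -/
noncomputable def topDeg (f : R) : M := sSup (deg '' support V f)

theorem isGreatest_topDeg {f : R} (hf : f ≠ 0) :
    IsGreatest (deg '' support V f) (topDeg V deg f) := by
  have hfin := (support_finite V f).image deg
  have hne := (support_nonempty V hf).image deg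
  exact ⟨hne.csSup_mem hfin, (isLUB_csSup hne hfin.bddAbove).1⟩

theorem le_topDeg {f : R} {α : Fin m → ℤ} (hα : α ∈ support V f) :
    deg α ≤ topDeg V deg f :=
  le_csSup ((support_finite V f).image deg).bddAbove (Set.mem_image_of_mem deg hα)

theorem exists_deg_eq_topDeg {f : R} (hf : f ≠ 0) :
    ∃ α ∈ support V f, deg α = topDeg V deg f := (isGreatest_topDeg V deg hf).1

theorem part_topDeg_ne_zero {f : R} (hf : f ≠ 0) : part V deg (topDeg V deg f) f ≠ 0 := by
  obtain ⟨α, hα, h⟩ := exists_deg_eq_topDeg V deg hf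
  exact h ▸ part_ne_zero V deg hα

theorem topDeg_neg (f : R) : topDeg V deg (-f) = topDeg V deg f := by
  rw [topDeg, support_neg, topDeg]

variable [IsOrderedAddMonoid M]

/-- A product involving a term below the top degree of either factor cannot reach the sum of the top
degrees. -/
theorem part_topDeg_mul (f g : R) :
    part V deg (topDeg V deg f + topDeg V deg g) (f * g) =
      part V deg (topDeg V deg f) f * part V deg (topDeg V deg g) g := by
  set a := topDeg V deg f
  set b := topDeg V deg g
  have h : f * g = part V deg a f * g + (f - part V deg a f) * g := by
    rw [← add_mul, add_sub_cancel]
  rw [h, part_add, part_isHomogeneous_mul (isHomogeneous_part V deg a f),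
    part_eq_zero V deg (f := (f - _) * g), add_zero]
  intro γ hγ
  obtain ⟨α, hα, β, hβ, rfl⟩ := support_mul V hγ
  have h1 := support_sub_part V deg hα
  rw [map_add]
  exact (add_lt_add_of_lt_of_le (lt_of_le_of_ne (le_topDeg V deg h1.1) h1.2)
    (le_topDeg V deg hβ)).ne

theorem topDeg_mul {f g : R} (hf : f ≠ 0) (hg : g ≠ 0) :
    topDeg V deg (f * g) = topDeg V deg f + topDeg V deg g := by
  have := noZeroDivisors V
  have hfg := mul_ne_zero hf hg
  apply le_antisymm
  · obtain ⟨γ, hγ, h⟩ := exists_deg_eq_topDeg V deg hfg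
    obtain ⟨α, hα, β, hβ, rfl⟩ := support_mul V hγ
    rw [← h, map_add]
    exact add_le_add (le_topDeg V deg hα) (le_topDeg V deg hβ)
  · have h : part V deg (topDeg V deg f + topDeg V deg g) (f * g) ≠ 0 := by
      rw [part_topDeg_mul]
      exact mul_ne_zero (part_topDeg_ne_zero V deg hf) (part_topDeg_ne_zero V deg hg)
    obtain ⟨α, hα, hd⟩ : ∃ α ∈ support V (f * g), deg α = topDeg V deg f + topDeg V deg g := by
      by_contra! hn
      exact h (part_eq_zero V deg hn)
    rw [← hd]
    exact le_topDeg V deg hα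

theorem topDeg_one : topDeg V deg (1 : R) = 0 := by
  have := nontrivial V
  have h := topDeg_mul V deg (one_ne_zero (α := R)) (one_ne_zero (α := R))
  rw [mul_one] at h
  exact left_eq_add.1 h

end Top
end Components
-- Euclidean elimination up to factors of degree zero
section Elimination
variable {K R : Type*} [DivisionRing K] [Ring R] [Module K R] [IsScalarTower K R R] {m : ℕ}
  (V : (Fin m → ℤ) → Submodule K R) [hV : IsSkewLaurentGrading V]

/-- Comparing homogeneous parts in an arbitrary Ore relation gives a homogeneous relation; a left
factor from V(-γ) shifts the multiplier of `x` to degree 0. -/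
theorem exists_homogeneous_ore {M : Type*} [AddCommGroup M] (deg : (Fin m → ℤ) →+ M) {a b : M}
    {x y : R} (hx : IsHomogeneous V deg a x) (hy : IsHomogeneous V deg b y) (hy0 : y ≠ 0) :
    ∃ s q : R, s ≠ 0 ∧ IsHomogeneous V deg 0 s ∧ IsHomogeneous V deg (a - b) q ∧
      s * x = q * y := by
  have := nontrivial V
  have := noZeroDivisors V
  obtain ⟨q, s, h⟩ := ore_condition V x ⟨y, mem_nonZeroDivisors_of_ne_zero hy0⟩
  obtain ⟨γ, hγ⟩ := support_nonempty V (nonZeroDivisors.coe_ne_zero s)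
  obtain ⟨t, ht, ht0⟩ := exists_ne_zero_mem V (-γ)
  have ht' : IsHomogeneous V deg (-deg γ) t := map_neg deg γ ▸ IsHomogeneous.of_mem ht
  refine ⟨t * part V deg (deg γ) s, t * part V deg (deg γ + (a - b)) q,
    mul_ne_zero ht0 (part_ne_zero V deg hγ), ?_, ?_, ?_⟩
  · simpa using ht'.mul (isHomogeneous_part V deg (deg γ) (s : R))
  · simpa using ht'.mul (isHomogeneous_part V deg (deg γ + (a - b)) q)
  · rw [mul_assoc, mul_assoc, ← part_mul_of_isHomogeneous hx, ← part_mul_of_isHomogeneous hy, h]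
    congr 2
    abel

/-- The difference between the largest and the smallest degree of an exponent of `f`. -/
noncomputable def degWidth (deg : (Fin m → ℤ) →+ ℤ) (f : R) : ℤ :=
  topDeg V deg f + topDeg V (-deg) f

theorem degWidth_nonneg (deg : (Fin m → ℤ) →+ ℤ) {f : R} (hf : f ≠ 0) :
    0 ≤ degWidth V deg f := by
  obtain ⟨α, hα⟩ := support_nonempty V hf
  have h1 := le_topDeg V deg hα
  have h2 := le_topDeg V (-deg) hα
  rw [AddMonoidHom.neg_apply] at h2
  rw [degWidth]
  omega

/-- One step of long division: `s` and `q` are chosen so that the top parts of `s * r` and `q * v`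
cancel. The inequality of widths ensures that `q * v` does not reach below the lowest degree of `r`.
-/
theorem exists_degWidth_sub_lt (deg : (Fin m → ℤ) →+ ℤ) {r v : R} (hv : v ≠ 0)
    (hrv : degWidth V deg v ≤ degWidth V deg r) :
    ∃ s q : R, s ≠ 0 ∧ IsHomogeneous V deg 0 s ∧
      (s * r - q * v ≠ 0 → degWidth V deg (s * r - q * v) < degWidth V deg r) := by
  set a := topDeg V deg r with ha
  set b := topDeg V deg v with hb
  obtain ⟨s, q, hs0, hs, hq, h⟩ := exists_homogeneous_ore V deg (isHomogeneous_part V deg a r)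
    (isHomogeneous_part V deg b v) (part_topDeg_ne_zero V deg hv)
  refine ⟨s, q, hs0, hs, fun hne => ?_⟩
  have hzero : part V deg a (s * r - q * v) = 0 := by
    have h1 := part_isHomogeneous_mul hs a r
    have h2 := part_isHomogeneous_mul hq b v
    rw [zero_add] at h1
    rw [sub_add_cancel] at h2
    have h3 := part_add V deg a (s * r - q * v) (q * v)
    rw [sub_add_cancel, h1, h2, h] at h3
    exact right_eq_add.1 h3
  have hsupp : ∀ α ∈ support V (s * r - q * v), deg α < a ∧ -deg α ≤ topDeg V (-deg) r := by
    intro α hα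
    have hαa : deg α ≠ a := by
      intro e
      exact part_ne_zero V deg hα (e ▸ hzero)
    have hle : deg α ≤ a ∧ -deg α ≤ topDeg V (-deg) r := by
      rw [sub_eq_add_neg] at hα
      rcases support_add V hα with hα | hα
      · obtain ⟨σ, hσ, ρ, hρ, rfl⟩ := support_mul V hα
        rw [map_add, hs σ hσ, zero_add]
        exact ⟨le_topDeg V deg hρ, le_topDeg V (-deg) hρ⟩
      · rw [support_neg] at hα
        obtain ⟨σ, hσ, ρ, hρ, rfl⟩ := support_mul V hα
        have h1 := le_topDeg V deg hρ
        have h2 := le_topDeg V (-deg) hρ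
        rw [AddMonoidHom.neg_apply] at h2
        rw [degWidth, degWidth] at hrv
        rw [map_add, hq σ hσ]
        omega
    exact ⟨lt_of_le_of_ne hle.1 hαa, hle.2⟩
  obtain ⟨α, hα, h1⟩ := exists_deg_eq_topDeg V deg hne
  obtain ⟨β, hβ, h2⟩ := exists_deg_eq_topDeg V (-deg) hne
  rw [degWidth, degWidth, ← h1, ← h2]
  exact add_lt_add_of_lt_of_le (hsupp α hα).1 (hsupp β hβ).2

/-- Division with remainder by `v`, up to left multiplication by an element of degree `0`. -/
theorem exists_pseudo_division (deg : (Fin m → ℤ) →+ ℤ) {v : R} (hv : v ≠ 0) (r : R) :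
    ∃ s q : R, s ≠ 0 ∧ IsHomogeneous V deg 0 s ∧
      (s * r - q * v ≠ 0 → degWidth V deg (s * r - q * v) < degWidth V deg v) := by
  have := nontrivial V
  have := noZeroDivisors V
  induction hN : (degWidth V deg r).toNat using Nat.strong_induction_on generalizing r with
  | _ N ih =>
    by_cases hr : r = 0
    · exact ⟨1, 0, one_ne_zero, IsHomogeneous.one, fun h => absurd (by simp [hr]) h⟩
    by_cases hrv : degWidth V deg v ≤ degWidth V deg r
    · obtain ⟨s, q, hs0, hs, h⟩ := exists_degWidth_sub_lt V deg hv hrv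
      by_cases h0 : s * r - q * v = 0
      · exact ⟨s, q, hs0, hs, fun hne => absurd h0 hne⟩
      · have h1 := degWidth_nonneg V deg h0
        obtain ⟨s', q', hs0', hs', h'⟩ := ih _ (by have := h h0; omega) (s * r - q * v) rfl
        have e : s' * s * r - (s' * q + q') * v = s' * (s * r - q * v) - q' * v := by
          noncomm_ring
        refine ⟨s' * s, s' * q + q', mul_ne_zero hs0' hs0, add_zero (0 : ℤ) ▸ hs'.mul hs, ?_⟩
        rwa [e]
    · exact ⟨1, 0, one_ne_zero, IsHomogeneous.one, fun _ => by simpa using hrv⟩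

variable {D G : Type*} [DivisionRing D] [CommGroupWithZero G] (χ : D →*₀ G) (σ : R →+* D)

/-- The order of the factors in `R` is immaterial, because only the value under χ counts and its
target is commutative. -/
theorem exists_prod_eq (deg : (Fin m → ℤ) →+ ℤ) {ι : Type} (t : Finset ι) (x : ι → R)
    (hx : ∀ i ∈ t, x i ≠ 0 ∧ IsHomogeneous V deg 0 (x i)) :
    ∃ u : R, u ≠ 0 ∧ IsHomogeneous V deg 0 u ∧ χ (σ u) = ∏ i ∈ t, χ (σ (x i)) := by
  classical
  have := nontrivial V
  have := noZeroDivisors V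
  induction t using Finset.induction_on with
  | empty => exact ⟨1, one_ne_zero, IsHomogeneous.one, by simp⟩
  | insert i t hi ih =>
    obtain ⟨u, hu0, hu, h⟩ := ih fun j hj => hx j (Finset.mem_insert_of_mem hj)
    obtain ⟨hi0, hi'⟩ := hx i (Finset.mem_insert_self i t)
    refine ⟨x i * u, mul_ne_zero hi0 hu0, add_zero (0 : ℤ) ▸ hi'.mul hu, ?_⟩
    rw [Finset.prod_insert hi, map_mul, map_mul, h]

/-- The determinant is either zero or a fraction of elements of `R` with a denominator all of whose
exponents have degree `0`. -/
def IsDegZeroFraction (deg : (Fin m → ℤ) →+ ℤ) (d : G) : Prop :=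
  d = 0 ∨ ∃ r u : R, r ≠ 0 ∧ u ≠ 0 ∧ IsHomogeneous V deg 0 u ∧ χ (σ u) * d = χ (σ r)

theorem IsDegZeroFraction.mul_left {deg : (Fin m → ℤ) →+ ℤ} {d : G}
    (h : IsDegZeroFraction V χ σ deg d) {a : R} (ha : a ≠ 0) :
    IsDegZeroFraction V χ σ deg (χ (σ a) * d) := by
  have := noZeroDivisors V
  rcases h with rfl | ⟨r, u, hr, hu, hu', h⟩
  · exact Or.inl (mul_zero _)
  · refine Or.inr ⟨a * r, u, mul_ne_zero ha hr, hu, hu', ?_⟩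
    rw [mul_left_comm, h, map_mul, map_mul]

theorem IsDegZeroFraction.of_mul_left {deg : (Fin m → ℤ) →+ ℤ} {d : G} {a : R} (ha : a ≠ 0)
    (hσ : Function.Injective σ) (ha' : IsHomogeneous V deg 0 a)
    (h : IsDegZeroFraction V χ σ deg (χ (σ a) * d)) : IsDegZeroFraction V χ σ deg d := by
  have := noZeroDivisors V
  rcases h with h | ⟨r, u, hr, hu, hu', h⟩
  · refine Or.inl ((mul_eq_zero.1 h).resolve_left ?_)
    exact (map_ne_zero χ).2 ((map_ne_zero_iff σ hσ).2 ha)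
  · refine Or.inr ⟨r, u * a, hr, mul_ne_zero hu ha, add_zero (0 : ℤ) ▸ hu'.mul ha', ?_⟩
    rw [map_mul, map_mul, mul_assoc, h]

/-- Euclidean algorithm on the last column, with an outer induction on the size and an inner one on
the degree width of the pivot entry. -/
theorem isDegZeroFraction_rowDet (hχ : χ (-1) = 1) (hσ : Function.Injective σ)
    (deg : (Fin m → ℤ) →+ ℤ) (n : ℕ) {ι : Type} [DecidableEq ι] (s : Finset ι)
    (A : ι → Fin n → R) (hs : s.card = n) :
    IsDegZeroFraction V χ σ deg (rowDet χ n s fun i k => σ (A i k)) := by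
  have := nontrivial V
  induction n generalizing s with
  | zero => exact Or.inr ⟨1, 1, one_ne_zero, one_ne_zero, IsHomogeneous.one, by simp [rowDet]⟩
  | succ n ihn =>
    by_cases hex : ∃ i ∈ s, A i (Fin.last n) ≠ 0
    swap
    · push Not at hex
      exact Or.inl (rowDet_succ_of_forall_eq_zero χ fun i hi => by rw [hex i hi, map_zero])
    obtain ⟨i, hi, hAi⟩ := hex
    induction hN : (degWidth V deg (A i (Fin.last n))).toNat using Nat.strong_induction_on
      generalizing A i with
    | _ N ih =>
      -- Each row j ≠ i is multiplied by the degree-zero factor `x` and loses `q` times row `i`, so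
      -- that its last entry becomes the remainder modulo the pivot entry.
      choose x q hx0 hx h using exists_pseudo_division V deg hAi
      let x' : ι → R := fun j => if j = i then 1 else x (A j (Fin.last n))
      let c : ι → R := fun j => if j = i then 0 else -q (A j (Fin.last n))
      let B : ι → Fin (n + 1) → R := fun j k => x' j * A j k + c j * A i k
      have hx' : ∀ j ∈ s, x' j ≠ 0 ∧ IsHomogeneous V deg 0 (x' j) := by
        intro j _
        simp only [x']
        split_ifs
        · exact ⟨one_ne_zero, IsHomogeneous.one⟩
        · exact ⟨hx0 _, hx _⟩
      obtain ⟨u, hu0, hu, hprod⟩ := exists_prod_eq V χ σ deg s x' hx'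
      have hxi : x' i = 1 := if_pos rfl
      have hci : c i = 0 := if_pos rfl
      have hBi : B i = A i := by
        funext k
        simp [B, hxi, hci]
      have hdet : rowDet χ (n + 1) s (fun j k => σ (B j k)) =
          χ (σ u) * rowDet χ (n + 1) s (fun j k => σ (A j k)) := by
        rw [hprod, ← (rowDetInvariance χ hχ (n + 1)).scale s (fun j k => σ (A j k))
          (fun j => σ (x' j)) hs fun j hj => (map_ne_zero_iff σ hσ).2 (hx' j hj).1,
          ← (rowDetInvariance χ hχ (n + 1)).add s (fun j k => σ (x' j) * σ (A j k))
          (fun j => σ (c j)) i hs hi (by rw [hci, map_zero])]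
        congr 1
        funext j k
        simp only [B, map_add, map_mul, hxi, map_one, one_mul]
      refine IsDegZeroFraction.of_mul_left V χ σ hu0 hσ hu ?_
      rw [← hdet]
      have hBj : ∀ j, j ≠ i → B j (Fin.last n) =
          x (A j (Fin.last n)) * A j (Fin.last n) - q (A j (Fin.last n)) * A i (Fin.last n) := by
        intro j hj
        simp only [B, x', c, if_neg hj, neg_mul, sub_eq_add_neg]
      by_cases hclear : ∀ j ∈ s.erase i, B j (Fin.last n) = 0
      · have hBi0 : σ (B i (Fin.last n)) ≠ 0 := by
          rw [hBi]
          exact (map_ne_zero_iff σ hσ).2 hAi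
        have hcard : (s.erase i).card = n := by rw [Finset.card_erase_of_mem hi, hs]; rfl
        rw [rowDet_succ_of_pivot χ hχ s _ hs hi hBi0]
        refine IsDegZeroFraction.mul_left V χ σ ?_ (by rwa [hBi])
        -- The column is already clear, so pivoting changes no row of `s.erase i`. Agreement holds
        -- only on these rows, hence the detour through the identity embedding.
        have hred := (rowDetInvariance χ hχ n).map (s.erase i) (Function.Embedding.refl ι)
          (fun j k => σ (B j k.castSucc)) (pivotReduce (fun j k => σ (B j k)) i) hcard (by
            intro j hj
            funext k
            simp [pivotReduce, hclear j hj])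
        rw [Finset.map_refl] at hred
        rw [hred]
        exact ihn (s.erase i) (fun j k => B j k.castSucc) hcard
      · push Not at hclear
        -- A nonzero remainder serves as a new pivot of strictly smaller width.
        obtain ⟨j, hj, hBj0⟩ := hclear
        obtain ⟨hji, hjs⟩ := Finset.mem_erase.1 hj
        have hlt := h (A j (Fin.last n)) (by rwa [← hBj j hji])
        rw [← hBj j hji] at hlt
        have h1 := degWidth_nonneg V deg hBj0
        exact ih _ (by omega) B j hjs hBj0 rfl

end Elimination
-- Support functions of Newton polytopes and the seminorm
section Norm
variable {K R : Type*} [DivisionRing K] [Ring R] [Module K R] [IsScalarTower K R R] {m : ℕ}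
  (V : (Fin m → ℤ) → Submodule K R) [hV : IsSkewLaurentGrading V]

/-- The restriction of `φ` to `ℤ^m`. -/
def latticeHom (φ : Module.Dual ℝ (Fin m → ℝ)) : (Fin m → ℤ) →+ ℝ :=
  AddMonoidHom.mk' (fun α => φ fun i => (α i : ℝ)) fun α β => by
    rw [← map_add]
    congr 1
    funext i
    simp

/-- The support function `φ ↦ max φ(α)` of the Newton polytope of `f`, where `α` runs through the
support of `f`. -/
noncomputable def supportFun (f : R) (φ : Module.Dual ℝ (Fin m → ℝ)) : ℝ :=
  topDeg V (latticeHom φ) f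

theorem supportFun_mul {f g : R} (hf : f ≠ 0) (hg : g ≠ 0) :
    supportFun V (f * g) = supportFun V f + supportFun V g :=
  funext fun φ => topDeg_mul V (latticeHom φ) hf hg

theorem supportFun_one : supportFun V (1 : R) = 0 :=
  funext fun φ => topDeg_one V (latticeHom φ)

theorem le_supportFun {f : R} {α : Fin m → ℤ} (hα : α ∈ support V f)
    (φ : Module.Dual ℝ (Fin m → ℝ)) : latticeHom φ α ≤ supportFun V f φ :=
  le_topDeg V _ hα

theorem exists_eq_supportFun {f : R} (hf : f ≠ 0) (φ : Module.Dual ℝ (Fin m → ℝ)) :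
    ∃ α ∈ support V f, latticeHom φ α = supportFun V f φ :=
  exists_deg_eq_topDeg V _ hf

theorem supportFun_add_le {f : R} (hf : f ≠ 0) (φ ψ : Module.Dual ℝ (Fin m → ℝ)) :
    supportFun V f (φ + ψ) ≤ supportFun V f φ + supportFun V f ψ := by
  obtain ⟨α, hα, h⟩ := exists_eq_supportFun V hf (φ + ψ)
  rw [← h]
  exact add_le_add (le_supportFun V hα φ) (le_supportFun V hα ψ)

theorem supportFun_smul {f : R} (hf : f ≠ 0) {c : ℝ} (hc : 0 ≤ c)
    (φ : Module.Dual ℝ (Fin m → ℝ)) : supportFun V f (c • φ) = c * supportFun V f φ := by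
  apply le_antisymm
  · obtain ⟨α, hα, h⟩ := exists_eq_supportFun V hf (c • φ)
    rw [← h]
    exact mul_le_mul_of_nonneg_left (le_supportFun V hα φ) hc
  · obtain ⟨α, hα, h⟩ := exists_eq_supportFun V hf φ
    rw [← h]
    exact le_supportFun V hα (c • φ)

theorem width_eq {f : R} (hf : f ≠ 0) (φ : Module.Dual ℝ (Fin m → ℝ)) :
    width V f φ = supportFun V f φ + supportFun V f (-φ) := by
  apply IsGreatest.csSup_eq
  constructor
  · obtain ⟨α, hα, h1⟩ := exists_eq_supportFun V hf φ
    obtain ⟨β, hβ, h2⟩ := exists_eq_supportFun V hf (-φ)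
    exact ⟨α, hα, β, hβ, by rw [← h1, ← h2, sub_eq_add_neg]; rfl⟩
  · rintro _ ⟨α, hα, β, hβ, rfl⟩
    rw [sub_eq_add_neg]
    exact add_le_add (le_supportFun V hα φ) (le_supportFun V hβ (-φ))

theorem continuous_supportFun {f : R} (hf : f ≠ 0) :
    Continuous fun x : Fin m → ℝ => supportFun V f (dotProductEquiv ℝ (Fin m) x) := by
  obtain ⟨s, hs, -⟩ := exists_eq_sum_component V f
  have hne : s.Nonempty := by
    rw [← Finset.coe_nonempty, hs]
    exact support_nonempty V hf
  have h : (fun x : Fin m → ℝ => supportFun V f (dotProductEquiv ℝ (Fin m) x)) =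
      fun x => s.sup' hne fun α => ∑ i, x i * (α i : ℝ) := by
    funext x
    rw [supportFun, topDeg, ← hs, Finset.sup'_eq_csSup_image]
    rfl
  rw [h]
  exact Continuous.finset_sup'_apply hne fun α _ => by fun_prop

open Classical in
/-- The support function of the Newton polytope as a multiplicative map on `R`. -/
noncomputable def ringValue : R →* WithZero (Multiplicative (Module.Dual ℝ (Fin m → ℝ) → ℝ)) where
  toFun f := if f = 0 then 0 else (Multiplicative.ofAdd (supportFun V f) :)
  map_one' := by
    have := nontrivial V
    rw [if_neg one_ne_zero, supportFun_one]
    rfl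
  map_mul' f g := by
    have := noZeroDivisors V
    by_cases hf : f = 0
    · simp [hf]
    by_cases hg : g = 0
    · simp [hg]
    rw [if_neg hf, if_neg hg, if_neg (mul_ne_zero hf hg), supportFun_mul V hf hg]
    rfl

theorem ringValue_of_ne_zero {f : R} (hf : f ≠ 0) :
    ringValue V f = (Multiplicative.ofAdd (supportFun V f) :) := if_neg hf

theorem ringValue_zero : ringValue V (0 : R) = 0 := if_pos rfl

/-- The extension of `ringValue` to the quotient field as a multiplicative map. -/
noncomputable def fieldValueHom :
    QuotientField V →* WithZero (Multiplicative (Module.Dual ℝ (Fin m → ℝ) → ℝ)) :=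
  letI := oreSet V
  have := nontrivial V
  OreLocalization.universalMulHom (S := nonZeroDivisors R) (ringValue V)
    { toFun := fun s => Units.mk0 (ringValue V (s : R)) (by
        rw [ringValue_of_ne_zero V (nonZeroDivisors.coe_ne_zero s)]
        exact WithZero.coe_ne_zero)
      map_one' := Units.ext (map_one (ringValue V))
      map_mul' := fun s t => Units.ext (map_mul (ringValue V) (s : R) t) } fun _ => rfl

theorem fieldValueHom_toQuotientField (f : R) :
    fieldValueHom V (toQuotientField V f) = ringValue V f :=
  letI := oreSet V
  OreLocalization.universalMulHom_commutes _ _ fun _ => rfl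

/-- The extension of the support function of the Newton polytope to the quotient field. -/
noncomputable def fieldValue :
    QuotientField V →*₀ WithZero (Multiplicative (Module.Dual ℝ (Fin m → ℝ) → ℝ)) :=
  { fieldValueHom V with
    map_zero' := by
      have h := fieldValueHom_toQuotientField V 0
      rwa [map_zero, ringValue_zero] at h }

theorem fieldValue_toQuotientField {f : R} (hf : f ≠ 0) :
    fieldValue V (toQuotientField V f) = (Multiplicative.ofAdd (supportFun V f) :) :=
  (fieldValueHom_toQuotientField V f).trans (ringValue_of_ne_zero V hf)

theorem fieldValue_neg_one : fieldValue V (-1) = 1 := by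
  have := nontrivial V
  have h := fieldValue_toQuotientField V (neg_ne_zero.2 (one_ne_zero (α := R)))
  rw [map_neg, map_one] at h
  have h1 : supportFun V (-1 : R) = 0 := by
    rw [← supportFun_one V]
    exact funext fun φ => topDeg_neg V _ _
  rw [h, h1]
  rfl

/-- The Ore localization provides left fractions s⁻¹r; they agree with rs⁻¹ after abelianization. -/
theorem exists_fraction_eq (x : (QuotientField V)ˣ) :
    ∃ (fn fd : R) (hn : fn ≠ 0) (hd : fd ≠ 0),
      Abelianization.of (fraction V fn fd hn hd) = Abelianization.of x := by
  let := oreSet V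
  have := nontrivial V
  obtain ⟨r, s, h⟩ : ∃ (r : R) (s : nonZeroDivisors R),
      toQuotientField V s * x.val = toQuotientField V r := by
    obtain ⟨r, s, h⟩ : ∃ (r : R) (s : nonZeroDivisors R),
        (OreLocalization.oreDiv r s : OreLocalization (nonZeroDivisors R) R) = x.val :=
      OreLocalization.ind (fun r s => ⟨r, s, rfl⟩)
        (x.val : OreLocalization (nonZeroDivisors R) R)
    refine ⟨r, s, ?_⟩
    rw [← h]
    exact OreLocalization.mul_cancel (s := s) (t := 1)
  have hs : (s : R) ≠ 0 := nonZeroDivisors.coe_ne_zero s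
  have hr : r ≠ 0 := by
    rintro rfl
    rw [map_zero] at h
    exact mul_ne_zero (toQuotientField_ne_zero V hs) x.ne_zero h
  refine ⟨r, s, hr, hs, ?_⟩
  have hx : Units.mk0 _ (toQuotientField_ne_zero V hs) * x =
      Units.mk0 _ (toQuotientField_ne_zero V hr) := Units.ext h
  rw [fraction, ← hx, map_mul, map_mul, map_inv, mul_right_comm, mul_inv_cancel, one_mul]

theorem exists_isDetFraction (τ : K₁ (QuotientField V)) : ∃ fn fd : R, IsDetFraction V τ fn fd := by
  obtain ⟨a, rfl⟩ := K₁.ofUnits_surjective _ τ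
  obtain ⟨x, rfl⟩ := QuotientGroup.mk_surjective a
  obtain ⟨fn, fd, hn, hd, h⟩ := exists_fraction_eq V x
  exact ⟨fn, fd, hn, hd, congrArg (K₁.ofUnits _) h⟩

/-- The value of the Dieudonné determinant on `K₁`. -/
noncomputable def detValue (τ : K₁ (QuotientField V)) :
    WithZero (Multiplicative (Module.Dual ℝ (Fin m → ℝ) → ℝ)) :=
  K₁.det (fieldValue V) (fieldValue_neg_one V) τ

theorem IsDetFraction.detValue_eq {τ : K₁ (QuotientField V)} {fn fd : R}
    (h : IsDetFraction V τ fn fd) :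
    detValue V τ = (Multiplicative.ofAdd (supportFun V fn - supportFun V fd) :) := by
  obtain ⟨hn, hd, rfl⟩ := h
  rw [detValue, K₁.det_ofUnits, fraction, Units.val_mul, map_mul, Units.val_inv_eq_inv_val,
    map_inv₀, Units.val_mk0, Units.val_mk0, fieldValue_toQuotientField V hn,
    fieldValue_toQuotientField V hd, ← WithZero.coe_inv, ← WithZero.coe_mul, sub_eq_add_neg]
  rfl

theorem IsRepresentedOverRing.exists_fraction {τ : K₁ (QuotientField V)}
    (hτ : IsRepresentedOverRing V τ) (deg : (Fin m → ℤ) →+ ℤ) {fn fd : R}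
    (h : IsDetFraction V τ fn fd) :
    ∃ r u : R, r ≠ 0 ∧ u ≠ 0 ∧ IsHomogeneous V deg 0 u ∧
      supportFun V u + (supportFun V fn - supportFun V fd) = supportFun V r := by
  obtain ⟨n, B, A, hA, hAτ⟩ := hτ
  have hval : detValue V τ = rowDet (fieldValue V) n Finset.univ
      fun i k => toQuotientField V (B i k) := by
    rw [detValue, ← hAτ, K₁.det_ofGL, hA]
    rfl
  rcases isDegZeroFraction_rowDet V (fieldValue V) (toQuotientField V) (fieldValue_neg_one V)
    (toQuotientField_injective V) deg n Finset.univ (fun i k => B i k) (by simp) with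
    h0 | ⟨r, u, hr, hu, hu', h0⟩
  · rw [← hval, h.detValue_eq] at h0
    exact absurd h0 WithZero.coe_ne_zero
  · rw [← hval, h.detValue_eq, fieldValue_toQuotientField V hu, fieldValue_toQuotientField V hr,
      ← WithZero.coe_mul, WithZero.coe_inj] at h0
    exact ⟨r, u, hr, hu, hu', h0⟩

/-- The two functionals agree on ker deg, which contains the support of `u`. Hence a single exponent
maximizes both, and their sum attains the sum of the maxima. -/
theorem supportFun_add_of_proportional {deg : (Fin m → ℤ) →+ ℤ} {u : R} (hu0 : u ≠ 0)
    (hu : IsHomogeneous V deg 0 u) {φ ψ : Module.Dual ℝ (Fin m → ℝ)} {c : ℝ}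
    (h : ∀ α, latticeHom φ α - latticeHom ψ α = c * deg α) :
    supportFun V u (φ + ψ) = supportFun V u φ + supportFun V u ψ := by
  have h0 : ∀ α ∈ support V u, latticeHom φ α = latticeHom ψ α := fun α hα => by
    rw [← sub_eq_zero, h, hu α hα, Int.cast_zero, mul_zero]
  refine le_antisymm (supportFun_add_le V hu0 φ ψ) ?_
  obtain ⟨α, hα, h1⟩ := exists_eq_supportFun V hu0 φ
  obtain ⟨β, hβ, h2⟩ := exists_eq_supportFun V hu0 ψ
  have h3 : supportFun V u ψ ≤ latticeHom ψ α := by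
    rw [← h0 α hα, h1, ← h2, ← h0 β hβ]
    exact le_supportFun V hβ φ
  rw [← h1]
  exact (add_le_add_right h3 _).trans (le_supportFun V hα (φ + ψ))

/-- The support function of the Newton polytope of the determinant is subadditive along rational
directions. -/
theorem IsRepresentedOverRing.sub_add_le {τ : K₁ (QuotientField V)}
    (hτ : IsRepresentedOverRing V τ) {fn fd : R} (h : IsDetFraction V τ fn fd)
    (φ ψ : Module.Dual ℝ (Fin m → ℝ)) :
    supportFun V fn (φ + ψ) - supportFun V fd (φ + ψ) ≤
      (supportFun V fn φ - supportFun V fd φ) + (supportFun V fn ψ - supportFun V fd ψ) := by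
  obtain ⟨x, rfl⟩ := (dotProductEquiv ℝ (Fin m)).surjective φ
  obtain ⟨y, rfl⟩ := (dotProductEquiv ℝ (Fin m)).surjective ψ
  -- Both sides of the inequality are continuous in the pair, so rational pairs suffice.
  have hdense : DenseRange fun p : (Fin m → ℚ) × (Fin m → ℚ) =>
      ((fun i => (p.1 i : ℝ), fun i => (p.2 i : ℝ)) : (Fin m → ℝ) × (Fin m → ℝ)) := by
    have h1 : DenseRange fun q : Fin m → ℚ => fun i => (q i : ℝ) :=
      DenseRange.piMap fun _ => Rat.denseRange_cast
    exact h1.prodMap h1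
  obtain ⟨hn, hd, -⟩ := id h
  have hcn := continuous_supportFun V hn
  have hcd := continuous_supportFun V hd
  refine hdense.induction_on (p := fun z : (Fin m → ℝ) × (Fin m → ℝ) =>
    supportFun V fn (dotProductEquiv ℝ (Fin m) z.1 + dotProductEquiv ℝ (Fin m) z.2) -
      supportFun V fd (dotProductEquiv ℝ (Fin m) z.1 + dotProductEquiv ℝ (Fin m) z.2) ≤
    (supportFun V fn (dotProductEquiv ℝ (Fin m) z.1) -
      supportFun V fd (dotProductEquiv ℝ (Fin m) z.1)) +
    (supportFun V fn (dotProductEquiv ℝ (Fin m) z.2) -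
      supportFun V fd (dotProductEquiv ℝ (Fin m) z.2))) (x, y) ?_ ?_
  · refine isClosed_le ?_ ?_
    · simp only [← map_add]
      exact (hcn.comp (continuous_fst.add continuous_snd)).sub
        (hcd.comp (continuous_fst.add continuous_snd))
    · exact ((hcn.comp continuous_fst).sub (hcd.comp continuous_fst)).add
        ((hcn.comp continuous_snd).sub (hcd.comp continuous_snd))
  · rintro ⟨p, q⟩
    -- `N` clears denominators: N(p - q) is the integral vector `z`, and pairing with `z` is the
    -- degree for which φ and ψ agree on degree-zero exponents.
    let N : ℕ := ∏ i, (p i - q i).den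
    have hN : (N : ℝ) ≠ 0 := by
      simp only [N, Nat.cast_ne_zero, Finset.prod_ne_zero_iff]
      exact fun i _ => (p i - q i).den_nz
    have hz : ∀ i, ∃ z : ℤ, (N : ℝ) * (p i - q i) = z := by
      intro i
      obtain ⟨k, hk⟩ := Finset.dvd_prod_of_mem (fun i => (p i - q i).den) (Finset.mem_univ i)
      refine ⟨k * (p i - q i).num, ?_⟩
      have h1 : (p i - q i : ℚ) * (p i - q i).den = (p i - q i).num := Rat.mul_den_eq_num _
      have h2 : (N : ℚ) * (p i - q i) = k * (p i - q i).num := by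
        rw [← h1]
        simp only [N, hk]
        push_cast
        ring
      exact_mod_cast h2
    choose z hz using hz
    let deg : (Fin m → ℤ) →+ ℤ := AddMonoidHom.mk' (fun α => ∑ i, z i * α i) fun α β => by
      simp only [Pi.add_apply, mul_add, Finset.sum_add_distrib]
    obtain ⟨r, u, hr, hu, hu', hru⟩ := hτ.exists_fraction V deg h
    set φ := dotProductEquiv ℝ (Fin m) fun i => (p i : ℝ)
    set ψ := dotProductEquiv ℝ (Fin m) fun i => (q i : ℝ)
    have hprop : ∀ α, latticeHom φ α - latticeHom ψ α = (N : ℝ)⁻¹ * deg α := by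
      intro α
      rw [eq_inv_mul_iff_mul_eq₀ hN]
      change (N : ℝ) * (∑ i, (p i : ℝ) * (α i : ℝ) - ∑ i, (q i : ℝ) * (α i : ℝ)) =
        ((∑ i, z i * α i : ℤ) : ℝ)
      rw [← Finset.sum_sub_distrib, Finset.mul_sum]
      push_cast
      refine Finset.sum_congr rfl fun i _ => ?_
      rw [← hz, ← sub_mul, mul_assoc]
    have h1 := supportFun_add_of_proportional V hu hu' hprop
    have h2 := supportFun_add_le V hr φ ψ
    -- Here h_u + h_τ = h_r; additivity of h_u on this pair transfers the subadditivity of h_r to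
    -- h_τ.
    have h3 := fun φ => congrFun hru φ
    simp only [Pi.add_apply, Pi.sub_apply] at h3
    have := h3 φ
    have := h3 ψ
    have := h3 (φ + ψ)
    change supportFun V fn (φ + ψ) - supportFun V fd (φ + ψ) ≤
      (supportFun V fn φ - supportFun V fd φ) + (supportFun V fn ψ - supportFun V fd ψ)
    linarith

theorem width_smul {f : R} (hf : f ≠ 0) (c : ℝ) (φ : Module.Dual ℝ (Fin m → ℝ)) :
    width V f (c • φ) = |c| * width V f φ := by
  rw [width_eq V hf, width_eq V hf, ← smul_neg c φ]
  rcases le_total 0 c with hc | hc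
  · rw [supportFun_smul V hf hc, supportFun_smul V hf hc, abs_of_nonneg hc, mul_add]
  · have h1 : c • φ = (-c) • (-φ) := by simp
    have h2 : c • (-φ) = (-c) • φ := LinearMap.ext fun x => by simp
    rw [h1, h2, supportFun_smul V hf (neg_nonneg.2 hc), supportFun_smul V hf (neg_nonneg.2 hc),
      abs_of_nonpos hc]
    ring

/-- The seminorm `φ ↦ ‖φ‖_{f_n} - ‖φ‖_{f_d}`, where `f_n f_d⁻¹` is the determinant of `τ`. -/
noncomputable def IsRepresentedOverRing.seminorm {τ : K₁ (QuotientField V)}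
    (hτ : IsRepresentedOverRing V τ) {fn fd : R} (h : IsDetFraction V τ fn fd) :
    Seminorm ℝ (Module.Dual ℝ (Fin m → ℝ)) :=
  Seminorm.of (fun φ => width V fn φ - width V fd φ)
    (fun φ ψ => by
      obtain ⟨hn, hd, -⟩ := id h
      -- The difference of widths is h_τ(φ) + h_τ(-φ), so subadditivity is applied to (φ, ψ) and to
      -- (-φ, -ψ).
      simp only [width_eq V hn, width_eq V hd, neg_add]
      have h1 := hτ.sub_add_le V h φ ψ
      have h2 := hτ.sub_add_le V h (-φ) (-ψ)
      linarith)
    fun c φ => by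
      obtain ⟨hn, hd, -⟩ := id h
      rw [width_smul V hn, width_smul V hd, Real.norm_eq_abs, mul_sub]

end Norm
end SkewLaurent

theorem mainTheorem2 {K R : Type*} [DivisionRing K] [Ring R] [Module K R] [IsScalarTower K R R]
    {m : ℕ} (V : (Fin m → ℤ) → Submodule K R) [SkewLaurent.IsSkewLaurentGrading V]
    (τ : SkewLaurent.K₁ (SkewLaurent.QuotientField V))
    (hτ : SkewLaurent.IsRepresentedOverRing V τ) :
    (∃ fn fd : R, SkewLaurent.IsDetFraction V τ fn fd) ∧
    ∃ p : Seminorm ℝ (Module.Dual ℝ (Fin m → ℝ)),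
      ∀ fn fd : R, SkewLaurent.IsDetFraction V τ fn fd →
        ∀ φ : Module.Dual ℝ (Fin m → ℝ),
          p φ = max 0 (SkewLaurent.width V fn φ - SkewLaurent.width V fd φ) := by
  obtain ⟨gn, gd, hg⟩ := SkewLaurent.exists_isDetFraction V τ
  refine ⟨⟨gn, gd, hg⟩, hτ.seminorm V hg, fun fn fd hf φ => ?_⟩
  have h : SkewLaurent.width V gn φ - SkewLaurent.width V gd φ =
      SkewLaurent.width V fn φ - SkewLaurent.width V fd φ := by
    have h1 := hg.detValue_eq V
    rw [hf.detValue_eq V, WithZero.coe_inj] at h1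
    have h2 := fun φ => congrFun (Multiplicative.ofAdd.injective h1) φ
    simp only [Pi.sub_apply] at h2
    obtain ⟨hgn, hgd, -⟩ := hg
    obtain ⟨hfn, hfd, -⟩ := hf
    rw [SkewLaurent.width_eq V hgn, SkewLaurent.width_eq V hgd, SkewLaurent.width_eq V hfn,
      SkewLaurent.width_eq V hfd]
    linarith [h2 φ, h2 (-φ)]
  rw [← h]
  -- Seminorms are nonnegative, so the maximum with 0 changes nothing.
  exact (max_eq_right (apply_nonneg (hτ.seminorm V hg) φ)).symm
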